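/- Let $d\ge 1$ and let $\mathbb S^d$ be the unit sphere of $\mathbb R^{d+1}$ with its surface measure $\sigma$ normalized to total mass $1$. For $k\ge 0$ let $\mathcal H_k^d$ be the space of real spherical harmonics of degree $k$ on $\mathbb S^d$ (restrictions of harmonic homogeneous polynomials of degree $k$), let $\tau_k^d=\dim\mathcal H_k^d$, and let $S_{k,1},\dots,S_{k,\tau_k^d}$ be a basis of $\mathcal H_k^d$ that is orthonormal in $L^2(\mathbb S^d,\sigma)$. Suppose that $0<\delta<\frac1{d+3}$ if $d\ge 2$, and $0<\delta<1$ if $d=1$, and consider the kernel of the Gaussian type $$K_\delta(x,y)=\sum_{k=0}^\infty \delta^k\sum_{j=1}^{\tau_k^d}S_{k,j}(x)S_{k,j}(y),\qquad x,y\in\mathbb S^d .$$ Let $\mathcal H_K$ be the real reproducing kernel Hilbert space of $K_\delta$. Then every element of $\mathcal H_K$ is a continuous function, and the embedding $I_K:\mathcal H_K\to C(\mathbb S^d)$ into the space of continuous functions with the supremum norm is bounded. For $\epsilon>0$ let $\mathcal C(\epsilon,I_K)$ be the minimal number of closed balls of radius $\epsilon$ in $C(\mathbb S^d)$ that cover the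 image under $I_K$ of the closed unit ball of $\mathcal H_K$; this number is finite. Then $$\frac{1}{2(d+1)!}\left[\frac{d/(d+1)}{\ln(e^{d-1}/\delta)}\right]^d\le\liminf_{\epsilon\to0^+}\frac{\ln\mathcal C(\epsilon,I_K)}{[2\ln(1/\epsilon)]^{d+1}}\le\limsup_{\epsilon\to0^+}\frac{\ln\mathcal C(\epsilon,I_K)}{[2\ln(1/\epsilon)]^{d+1}} .$$ If $\delta<\frac{1}{d+3}$ (which is automatic for $d\ge2$), then $$\limsup_{\epsilon\to0^+}\frac{\ln\mathcal C(\epsilon,I_K)}{[2\ln(1/\epsilon)]^{d+1}}\le\frac{2}{d!}\,\frac{1}{[\ln(1/(\delta(d+3)))]^d}.$$ If $d=1$, then for all $0<\delta<1$ $$\limsup_{\epsilon\to0^+}\frac{\ln\mathcal C(\epsilon,I_K)}{[2\ln(1/\epsilon)]^{2}}\le\frac{2}{\ln(1/\delta)} .$$ -/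

import Mathlib

open MeasureTheory Filter Topology

noncomputable section

/-- The unit sphere `S^d` of `ℝ^(d+1)`. -/
abbrev UnitSphere (d : ℕ) : Type :=
  Metric.sphere (0 : EuclideanSpace ℝ (Fin (d + 1))) 1

/-- The surface measure of `S^d`, normalized to be a probability measure. -/
def sphereMeasure (d : ℕ) : Measure (UnitSphere d) :=
  ((volume : Measure (EuclideanSpace ℝ (Fin (d + 1)))).toSphere Set.univ)⁻¹ •
    (volume : Measure (EuclideanSpace ℝ (Fin (d + 1)))).toSphere

/-- The Laplacian on polynomials in `n` variables. -/
def polyLaplacian (n : ℕ) : MvPolynomial (Fin n) ℝ →ₗ[ℝ] MvPolynomial (Fin n) ℝ :=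
  ∑ i : Fin n, (MvPolynomial.pderiv i).toLinearMap ∘ₗ (MvPolynomial.pderiv i).toLinearMap

/-- The `i`-th coordinate function on `S^d`. -/
def sphereCoord (d : ℕ) (i : Fin (d + 1)) : C(UnitSphere d, ℝ) where
  toFun x := (x : EuclideanSpace ℝ (Fin (d + 1))) i
  continuous_toFun := by fun_prop

/-- Restriction of polynomials in `d + 1` variables to `S^d`. -/
def sphereRestrict (d : ℕ) : MvPolynomial (Fin (d + 1)) ℝ →ₗ[ℝ] C(UnitSphere d, ℝ) :=
  (MvPolynomial.aeval (sphereCoord d)).toLinearMap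

/-- The space of spherical harmonics of degree `k` on `S^d`: the restrictions to the sphere of the
harmonic homogeneous polynomials of degree `k` in `d + 1` variables. -/
def sphericalHarmonics (d k : ℕ) : Submodule ℝ C(UnitSphere d, ℝ) :=
  (MvPolynomial.homogeneousSubmodule (Fin (d + 1)) ℝ k ⊓
    LinearMap.ker (polyLaplacian (d + 1))).map (sphereRestrict d)

/-- The dimension of the space of spherical harmonics of degree `k` on `S^d`. -/
def harmonicDim (d k : ℕ) : ℕ := Module.finrank ℝ (sphericalHarmonics d k)

/-- `K` is the kernel of the Gaussian type on `S^d` with parameter `δ`: for some bases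
`S k 0, S k 1, …` of the spaces of spherical harmonics of degree `k` that are orthonormal for the
normalized surface measure, `K x y = ∑ₖ δ ^ k ∑ⱼ S k j x * S k j y`. -/
def IsGaussianTypeKernel (d : ℕ) (δ : ℝ) (K : UnitSphere d → UnitSphere d → ℝ) : Prop :=
  ∃ S : (k : ℕ) → Module.Basis (Fin (harmonicDim d k)) ℝ (sphericalHarmonics d k),
    (∀ k i j, ∫ x, (S k i : C(UnitSphere d, ℝ)) x * (S k j : C(UnitSphere d, ℝ)) x
      ∂(sphereMeasure d) = if i = j then 1 else 0) ∧
    ∀ x y, HasSum (fun k : ℕ => δ ^ k * ∑ j, (S k j : C(UnitSphere d, ℝ)) x *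
      (S k j : C(UnitSphere d, ℝ)) y) (K x y)

/-- The covering number `C(ε, T)` of an operator `T : X → Y`: the minimal number of closed balls of
`Y` of radius `ε` that cover the image under `T` of the closed unit ball of `X`. -/
def operatorCoveringNumber {X Y : Type*} [NormedAddCommGroup X] [NormedSpace ℝ X]
    [NormedAddCommGroup Y] [NormedSpace ℝ Y] (ε : ℝ) (T : X →L[ℝ] Y) : ℕ∞ :=
  Metric.externalCoveringNumber ε.toNNReal (T '' Metric.closedBall 0 1)

/-- The quotient `ln C(ε, T) / (2 ln (1/ε)) ^ (d + 1)`. -/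
def entropyRatio {X Y : Type*} [NormedAddCommGroup X] [NormedSpace ℝ X]
    [NormedAddCommGroup Y] [NormedSpace ℝ Y] (d : ℕ) (T : X →L[ℝ] Y) (ε : ℝ) : EReal :=
  ((Real.log ((operatorCoveringNumber ε T).toNat : ℝ) /
    (2 * Real.log (1 / ε)) ^ (d + 1) : ℝ) : EReal)

end

/-! The map `x ↦ (δ^{k/2} S_{k,j}(x))` is a feature map of the kernel into the ℓ² sum of the
coefficient spaces. Hence the unit ball of `H` consists of the functions `∑ δ^{k/2} c_{k,j} S_{k,j}`
with `‖c‖ ≤ 1`, and its entropy in the sup norm is found by comparing volumes on finitely many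
degrees (`exists_embedding`).

Upper bound: reflection invariance gives `∑_j S_{k,j}(x)² ≤ τ_k` (`sum_sq_le_harmonicDim`), so the
degree `k` part has sup norm at most `√(δ^k τ_k)`. As `τ_k` grows polynomially, this is `O(r^{k/2})`
for every `r > δ`. Cutting at degree about `2 ln(1/ε) / ln(1/r)` costs `ε/2` and leaves a ball in a
space of polynomials of dimension at most about `(2/d!) N^d`, which is covered by a volume count
(`limsup_entropyRatio_le`). The dimension bound and the normalization by powers of `2 ln(1/ε)`
combine to `(1/d!) ln(1/r)^{-d}`; the 2 in the claim leaves room for `r = δ^θ` with `θ^{-d} ≤ 2`.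

Lower bound: on degrees up to `N` the unit ball contains the L² ball of radius `δ^{N/2}`, and the
sup norm dominates the L² norm. With `m ≥ N^d/d!` the total dimension, volumes give `ln C ≥ m
(ln(1/ε) - ln 2 - N ln(1/δ)/2)`, and `N` is optimized (`le_liminf_entropyRatio`). This needs
orthogonality between different degrees (`sphereIntegral_mul_eq_zero`).

Both bounds come out with `ln(1/δ)`, which implies the stated forms. -/

/-! ### Homogeneous polynomials and their restriction to the sphere -/

open MvPolynomial in
theorem MvPolynomial.aeval_continuousMap_apply {ι Y : Type*} [TopologicalSpace Y]
    (y : ι → C(Y, ℝ)) (p : MvPolynomial ι ℝ) (x : Y) :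
    aeval y p x = eval (fun i => y i x) p := by
  induction p using MvPolynomial.induction_on with
  | C a => simp
  | add p q hp hq => simp [hp, hq]
  | mul_X p i hp => simp [hp]

open MvPolynomial in
theorem sphereRestrict_apply (d : ℕ) (p : MvPolynomial (Fin (d + 1)) ℝ) (x : UnitSphere d) :
    sphereRestrict d p x = eval (fun i => (x : EuclideanSpace ℝ (Fin (d + 1))) i) p :=
  aeval_continuousMap_apply _ p x

open MvPolynomial in
theorem finrank_homogeneousSubmodule_fin (d k : ℕ) :
    Module.finrank ℝ (homogeneousSubmodule (Fin (d + 1)) ℝ k) = (k + d).choose d := by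
  let t : Finset (Fin (d + 1) →₀ ℕ) := Finset.univ.finsuppAntidiag k
  have ht : {m : Fin (d + 1) →₀ ℕ | m.degree = k} = (t : Set _) := by
    ext m
    simp [t, Finset.mem_finsuppAntidiag, Finsupp.degree_eq_sum]
  have e : homogeneousSubmodule (Fin (d + 1)) ℝ k =
      Submodule.span ℝ (Set.range (basisMonomials (Fin (d + 1)) ℝ ∘ ((↑) : t → Fin (d + 1) →₀ ℕ))) := by
    rw [homogeneousSubmodule_eq_finsupp_supported, ht]
    refine (restrictSupport_eq_span ℝ (t : Set (Fin (d + 1) →₀ ℕ))).trans ?_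
    congr 1
    ext p
    simp
  rw [e, finrank_span_eq_card ((basisMonomials (Fin (d + 1)) ℝ).linearIndependent.comp _
    Subtype.val_injective), Fintype.card_coe]
  rw [Finset.card_finsuppAntidiag_nat_eq_choose, Finset.card_univ, Fintype.card_fin,
    Nat.add_right_comm, Nat.add_sub_cancel, add_comm d k, Nat.choose_symm_add]

open MvPolynomial in
theorem MvPolynomial.IsHomogeneous.eval_smul {σ R : Type*} [CommSemiring R] {k : ℕ}
    {p : MvPolynomial σ R} (hp : p.IsHomogeneous k) (r : R) (v : σ → R) :
    eval (r • v) p = r ^ k * eval v p := by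
  rw [eval_eq, eval_eq, Finset.mul_sum]
  refine Finset.sum_congr rfl fun m hm => ?_
  have hk : ∑ i ∈ m.support, m i = k := by
    have := hp (mem_support_iff.1 hm)
    simpa [Finsupp.weight_apply, Finsupp.sum] using this
  simp only [Pi.smul_apply, smul_eq_mul, mul_pow, Finset.prod_mul_distrib,
    Finset.prod_pow_eq_pow_sum, hk]
  ring

-- Homogeneity spreads the vanishing from the sphere along every ray. Hence restriction to the
-- sphere preserves dimensions.
open MvPolynomial in
theorem eq_zero_of_sphereRestrict_eq_zero {d k : ℕ} {p : MvPolynomial (Fin (d + 1)) ℝ}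
    (hp : p.IsHomogeneous k) (h : sphereRestrict d p = 0) : p = 0 := by
  have key : ∀ (r : ℝ) (y : UnitSphere d),
      eval (r • fun i => (y : EuclideanSpace ℝ (Fin (d + 1))) i) p = 0 := fun r y => by
    rw [hp.eval_smul, ← sphereRestrict_apply, h]; simp
  refine hp.eq_zero_of_forall_eval_eq_zero fun v => ?_
  by_cases hv : v = 0
  · simpa [hv] using key 0 ⟨EuclideanSpace.single 0 1, by simp⟩
  · have hw : WithLp.toLp 2 v ≠ 0 := by simpa using hv
    have := key ‖WithLp.toLp 2 v‖ ⟨‖WithLp.toLp 2 v‖⁻¹ • WithLp.toLp 2 v, by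
      simp [norm_smul, norm_ne_zero_iff.2 hw]⟩
    have e : v = ‖WithLp.toLp 2 v‖ • fun i => (‖WithLp.toLp 2 v‖⁻¹ • WithLp.toLp 2 v) i := by
      ext i
      simp [mul_inv_cancel_left₀ (norm_ne_zero_iff.2 hw)]
    rw [e]; exact this

/-! ### Infinitesimal rotations and the Laplacian -/

open MvPolynomial in
theorem polyLaplacian_apply (n : ℕ) (p : MvPolynomial (Fin n) ℝ) :
    polyLaplacian n p = ∑ i, pderiv i (pderiv i p) := by
  simp [polyLaplacian]

open MvPolynomial in
/-- The infinitesimal rotation `xᵢ ∂ⱼ - xⱼ ∂ᵢ`. -/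
noncomputable def polyRot (n : ℕ) (i j : Fin n) :
    Derivation ℝ (MvPolynomial (Fin n) ℝ) (MvPolynomial (Fin n) ℝ) :=
  (X i : MvPolynomial (Fin n) ℝ) • pderiv j - (X j : MvPolynomial (Fin n) ℝ) • pderiv i

open MvPolynomial in
theorem polyRot_apply (n : ℕ) (i j : Fin n) (p : MvPolynomial (Fin n) ℝ) :
    polyRot n i j p = X i * pderiv j p - X j * pderiv i p := by
  simp [polyRot]

open MvPolynomial in
theorem polyRot_polyRot (n : ℕ) (i j : Fin n) (p : MvPolynomial (Fin n) ℝ) :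
    polyRot n i j (polyRot n i j p) =
      X i ^ 2 * pderiv j (pderiv j p) + X j ^ 2 * pderiv i (pderiv i p)
      - X i * (X j * pderiv j (pderiv i p)) - X j * (X i * pderiv i (pderiv j p))
      - X i * pderiv i p - X j * pderiv j p
      + if i = j then X i * pderiv i p + X j * pderiv j p else 0 := by
  simp only [polyRot_apply, map_sub, Derivation.leibniz, pderiv_X, smul_eq_mul, Pi.single_apply]
  by_cases h : i = j
  · subst h; simp; ring
  · simp [h, Ne.symm h]; ring

-- The sum of squared rotations is twice the spherical Laplacian, as each pair is counted in both
-- orders. The terms with `Δ` vanish and Euler's identity, applied to `p` and to its derivatives,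
-- evaluates the others.
open MvPolynomial in
theorem sum_polyRot_polyRot {n k : ℕ} {p : MvPolynomial (Fin n) ℝ} (hp : p.IsHomogeneous k)
    (hΔ : polyLaplacian n p = 0) :
    ∑ i, ∑ j, polyRot n i j (polyRot n i j p) = (-(2 * (k : ℝ) * (k + n - 2))) • p := by
  rw [polyLaplacian_apply] at hΔ
  have h1 : ∑ i, X i * pderiv i p = k • p := hp.sum_X_mul_pderiv
  have h2 : ∑ i, X i * ∑ j, X j * pderiv j (pderiv i p) = (k * (k - 1 : ℝ)) • p := by
    have : ∀ i, ∑ j, X j * pderiv j (pderiv i p) = (k - 1) • pderiv i p := fun i =>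
      hp.pderiv.sum_X_mul_pderiv
    simp only [this, mul_smul_comm, ← Finset.smul_sum, h1]
    rcases k with _ | k
    · simp
    · simp only [← Nat.cast_smul_eq_nsmul ℝ, smul_smul]
      push_cast; congr 1; simp; ring
  have h3 : ∑ i, ∑ j, X i ^ 2 * pderiv j (pderiv j p) = 0 := by
    simp [← Finset.mul_sum, hΔ]
  have h4 : ∑ i : Fin n, ∑ j, X j ^ 2 * pderiv i (pderiv i p) = 0 := by
    rw [Finset.sum_comm]; exact h3
  have h5 : ∑ i : Fin n, ∑ j, X j * (X i * pderiv i (pderiv j p)) = (k * (k - 1 : ℝ)) • p := by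
    rw [Finset.sum_comm]; simpa only [Finset.mul_sum] using h2
  simp only [Finset.mul_sum] at h2
  simp only [polyRot_polyRot, Finset.sum_add_distrib, Finset.sum_sub_distrib, h3, h4, h5, h2,
    Finset.sum_const, Finset.card_univ, Fintype.card_fin, Finset.sum_ite_eq, Finset.mem_univ,
    if_true, ← Finset.smul_sum, h1]
  simp only [← Nat.cast_smul_eq_nsmul ℝ, smul_smul]
  module

/-! ### Dimensions of the spaces of harmonics -/

open MvPolynomial in
theorem polyLaplacian_isHomogeneous {n k : ℕ} {p : MvPolynomial (Fin n) ℝ}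
    (hp : p.IsHomogeneous (k + 2)) : (polyLaplacian n p).IsHomogeneous k := by
  rw [polyLaplacian_apply]
  exact IsHomogeneous.sum _ _ _ fun i _ => hp.pderiv.pderiv

theorem LinearMap.finrank_map_of_injOn {V W : Type*} [AddCommGroup V] [Module ℝ V]
    [AddCommGroup W] [Module ℝ W] (f : V →ₗ[ℝ] W) (p : Submodule ℝ V)
    (h : ∀ v ∈ p, f v = 0 → v = 0) : Module.finrank ℝ (p.map f) = Module.finrank ℝ p := by
  rw [← LinearMap.range_domRestrict]
  refine LinearMap.finrank_range_of_inj ((injective_iff_map_eq_zero _).2 fun v hv => ?_)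
  exact Subtype.ext (h v v.2 hv)

open MvPolynomial in
theorem harmonicDim_eq (d k : ℕ) : harmonicDim d k =
    Module.finrank ℝ ↥(homogeneousSubmodule (Fin (d + 1)) ℝ k ⊓
      LinearMap.ker (polyLaplacian (d + 1))) := by
  exact LinearMap.finrank_map_of_injOn _ _ fun p hp h => eq_zero_of_sphereRestrict_eq_zero hp.1 h

open MvPolynomial in
theorem harmonicDim_le (d k : ℕ) : harmonicDim d k ≤ (k + d).choose d := by
  rw [harmonicDim_eq, ← finrank_homogeneousSubmodule_fin]
  have := (homogeneousSubmodule_fg (R := ℝ) (σ := Fin (d + 1)) k)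
  have : Module.Finite ℝ (homogeneousSubmodule (Fin (d + 1)) ℝ k) := Module.Finite.iff_fg.2 this
  exact Submodule.finrank_mono inf_le_left

open MvPolynomial in
theorem harmonicDim_of_le_one (d k : ℕ) (hk : k ≤ 1) : (k + d).choose d ≤ harmonicDim d k := by
  rw [harmonicDim_eq, ← finrank_homogeneousSubmodule_fin, inf_eq_left.2]
  intro p hp
  rw [LinearMap.mem_ker, polyLaplacian_apply]
  refine Finset.sum_eq_zero fun i _ => ?_
  have h : (pderiv i p).IsHomogeneous 0 := by
    have := (show p.IsHomogeneous k from hp).pderiv (i := i)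
    rwa [show k - 1 = 0 by omega] at this
  rw [← totalDegree_zero_iff_isHomogeneous, totalDegree_eq_zero_iff_eq_C] at h
  rw [h, pderiv_C]

-- Rank-nullity for the Laplacian from degree `k + 2` to degree `k`. Only a lower bound is wanted,
-- so its surjectivity is not needed.
open MvPolynomial in
theorem choose_le_harmonicDim_add (d k : ℕ) :
    (k + 2 + d).choose d ≤ harmonicDim d (k + 2) + (k + d).choose d := by
  rw [harmonicDim_eq, ← finrank_homogeneousSubmodule_fin, ← finrank_homogeneousSubmodule_fin]
  have (m : ℕ) : Module.Finite ℝ (homogeneousSubmodule (Fin (d + 1)) ℝ m) :=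
    Module.Finite.iff_fg.2 (homogeneousSubmodule_fg (R := ℝ) (σ := Fin (d + 1)) m)
  let L : homogeneousSubmodule (Fin (d + 1)) ℝ (k + 2) →ₗ[ℝ]
      homogeneousSubmodule (Fin (d + 1)) ℝ k :=
    (polyLaplacian (d + 1)).restrict fun p hp => polyLaplacian_isHomogeneous hp
  rw [← L.finrank_range_add_finrank_ker, add_comm]
  gcongr
  · refine le_of_eq ?_
    rw [← LinearMap.finrank_map_of_injOn (Submodule.subtype _) (LinearMap.ker L)
      (fun v _ h => Subtype.ext h)]
    suffices h : (LinearMap.ker L).map (Submodule.subtype _) =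
        homogeneousSubmodule (Fin (d + 1)) ℝ (k + 2) ⊓ LinearMap.ker (polyLaplacian (d + 1)) by
      rw [h]
    ext p
    simp only [Submodule.mem_map, LinearMap.mem_ker, Submodule.subtype_apply, Subtype.exists,
      Submodule.mem_inf]
    constructor
    · rintro ⟨q, hq, h, rfl⟩
      exact ⟨hq, congrArg Subtype.val h⟩
    · rintro ⟨hp, h⟩
      exact ⟨p, hp, Subtype.ext h, rfl⟩
  · exact Submodule.finrank_le _

/-- The differences telescope in steps of two, so one binomial of each parity survives. -/
theorem choose_le_sum_harmonicDim (d N : ℕ) :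
    (N + 1 + d).choose d + (N + d).choose d ≤ ∑ k ∈ Finset.range (N + 2), harmonicDim d k := by
  induction N with
  | zero =>
    rw [Finset.sum_range_succ, Finset.sum_range_one, add_comm]
    gcongr <;> exact harmonicDim_of_le_one d _ (by omega)
  | succ N ih =>
    rw [Finset.sum_range_succ]
    have := choose_le_harmonicDim_add d (N + 1)
    have := choose_le_harmonicDim_add d N
    have e : N + 1 + 1 + d = N + 2 + d := by ring
    rw [e]
    omega

theorem pow_div_factorial_le_sum_harmonicDim (d N : ℕ) :
    (N : ℝ) ^ d / d.factorial ≤ ((∑ k ∈ Finset.range (N + 1), harmonicDim d k : ℕ) : ℝ) := by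
  have h : (N + d).choose d ≤ ∑ k ∈ Finset.range (N + 1), harmonicDim d k := by
    rcases N with _ | N
    · simpa using harmonicDim_of_le_one d 0 (by omega)
    · exact le_trans (Nat.le_add_right _ _) (choose_le_sum_harmonicDim d N)
  have h2 : ((N + d + 1 - d : ℕ) ^ d : ℝ) / d.factorial ≤ (N + d).choose d :=
    Nat.pow_le_choose d (N + d)
  have h3 : (N : ℝ) ≤ ((N + d + 1 - d : ℕ) : ℝ) := by exact_mod_cast (by omega)
  calc (N : ℝ) ^ d / d.factorial ≤ ((N + d + 1 - d : ℕ) ^ d : ℝ) / d.factorial := by gcongr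
    _ ≤ ((N + d).choose d : ℝ) := h2
    _ ≤ _ := by exact_mod_cast h

/-! ### Reflections acting on polynomials -/

open MvPolynomial in
/-- Substitution of the reflection `x ↦ x - 2 ⟨u, x⟩ u` into a polynomial. -/
noncomputable def polyRefl {n : ℕ} (u : Fin n → ℝ) :
    MvPolynomial (Fin n) ℝ →ₐ[ℝ] MvPolynomial (Fin n) ℝ :=
  aeval fun l => X l - C (2 * u l) * ∑ m, C (u m) * X m

open MvPolynomial in
theorem polyRefl_isHomogeneous {n k : ℕ} (u : Fin n → ℝ) {p : MvPolynomial (Fin n) ℝ}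
    (hp : p.IsHomogeneous k) : (polyRefl u p).IsHomogeneous k := by
  rw [← one_mul k]
  refine hp.aeval _ fun l => (isHomogeneous_X _ _).sub (IsHomogeneous.C_mul ?_ _)
  exact IsHomogeneous.sum _ _ _ fun m _ => isHomogeneous_C_mul_X _ _

open MvPolynomial in
theorem eval_polyRefl {n : ℕ} (u v : Fin n → ℝ) (p : MvPolynomial (Fin n) ℝ) :
    eval v (polyRefl u p) = eval (fun l => v l - 2 * u l * ∑ m, u m * v m) p := by
  induction p using MvPolynomial.induction_on with
  | C a => simp [polyRefl]
  | add p q hp hq => simp [hp, hq]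
  | mul_X p i hp => rw [map_mul, map_mul, hp]; simp [polyRefl]

open MvPolynomial in
theorem pderiv_polyRefl {n : ℕ} (u : Fin n → ℝ) (i : Fin n) (p : MvPolynomial (Fin n) ℝ) :
    pderiv i (polyRefl u p) =
      ∑ l, C ((if l = i then 1 else 0) - 2 * u l * u i) * polyRefl u (pderiv l p) := by
  have hX : ∀ l, pderiv i (polyRefl u (X l)) = C ((if l = i then 1 else 0) - 2 * u l * u i) := by
    intro l
    simp only [polyRefl, aeval_X, map_sub, Derivation.leibniz, map_sum, pderiv_C, pderiv_X,
      Pi.single_apply, smul_eq_mul]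
    by_cases h : l = i <;> simp [h]
  induction p using MvPolynomial.induction_on with
  | C a => simp [polyRefl]
  | add p q hp hq => simp [hp, hq, mul_add, Finset.sum_add_distrib]
  | mul_X p j hp =>
    simp only [map_mul, Derivation.leibniz, map_add, smul_eq_mul, hX, hp, mul_add,
      Finset.sum_add_distrib, pderiv_X, Pi.single_apply]
    rw [add_comm, add_comm (∑ x, _)]
    simp only [mul_ite, mul_zero, apply_ite (polyRefl u), map_zero, Finset.sum_ite_eq,
      Finset.mem_univ, if_true, Finset.mul_sum]
    congr 1
    · exact Finset.sum_congr rfl fun l _ => by ring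
    · simp [mul_comm]

open MvPolynomial in
theorem polyLaplacian_polyRefl {n : ℕ} (u : Fin n → ℝ) (hu : ∑ i, u i ^ 2 = 1)
    (p : MvPolynomial (Fin n) ℝ) :
    polyLaplacian n (polyRefl u p) = polyRefl u (polyLaplacian n p) := by
  -- The matrix `1 - 2uuᵀ` is orthogonal; this collapses the double sum of second derivatives.
  have hR : ∀ l l' : Fin n, ∑ i, ((if l = i then 1 else 0) - 2 * u l * u i) *
      ((if l' = i then 1 else 0) - 2 * u l' * u i) = if l = l' then 1 else 0 := by
    intro l l'
    have : ∀ i, ((if l = i then 1 else 0) - 2 * u l * u i) *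
      ((if l' = i then 1 else 0) - 2 * u l' * u i) =
      (if l = i then (if l' = i then 1 else 0) else 0) - (if l = i then 2 * u l' * u i else 0)
      - (if l' = i then 2 * u l * u i else 0) + 4 * u l * u l' * u i ^ 2 := by
      intro i; split_ifs <;> ring
    simp only [this, Finset.sum_add_distrib, Finset.sum_sub_distrib, ← Finset.mul_sum, hu]
    simp [eq_comm (a := l')]
    ring
  generalize hRdef : (fun l i : Fin n => ((if l = i then 1 else 0) - 2 * u l * u i : ℝ)) = R
  have hR' : ∀ l l' : Fin n, ∑ i, R l i * R l' i = if l = l' then 1 else 0 := by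
    simpa [← hRdef] using hR
  have hp : ∀ (i : Fin n) (q : MvPolynomial (Fin n) ℝ),
      pderiv i (polyRefl u q) = ∑ l, C (R l i) * polyRefl u (pderiv l q) := by
    intro i q; rw [pderiv_polyRefl, ← hRdef]
  have h2 : ∀ i, pderiv i (pderiv i (polyRefl u p)) =
      ∑ l, ∑ l', C (R l i * R l' i) * polyRefl u (pderiv l' (pderiv l p)) := by
    intro i
    simp [hp, Derivation.leibniz, Finset.mul_sum, mul_assoc]
  simp only [polyLaplacian_apply, h2, map_sum]
  rw [Finset.sum_comm]
  refine Finset.sum_congr rfl fun l _ => ?_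
  rw [Finset.sum_comm]
  simp only [← Finset.sum_mul, ← map_sum, hR']
  simp [apply_ite]

/-! ### Invariant integration on the sphere -/

instance isProbabilityMeasure_sphereMeasure (d : ℕ) : IsProbabilityMeasure (sphereMeasure d) := by
  refine ⟨?_⟩
  rw [sphereMeasure, Measure.smul_apply, smul_eq_mul]
  refine ENNReal.inv_mul_cancel ?_ (measure_ne_top _ _)
  rw [Measure.measure_univ_ne_zero]
  exact Measure.toSphere_ne_zero _

/-- The action of a linear isometry on the sphere. -/
noncomputable def sphereIsometry {d : ℕ} (g : EuclideanSpace ℝ (Fin (d + 1)) ≃ₗᵢ[ℝ]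
    EuclideanSpace ℝ (Fin (d + 1))) : C(UnitSphere d, UnitSphere d) where
  toFun x := ⟨g x, by simp⟩
  continuous_toFun := by fun_prop

-- Surface measure is, up to a factor, the volume of the cone over a set, and a linear isometry
-- preserves volume and commutes with forming cones.
open scoped Pointwise in
theorem measurePreserving_sphereIsometry {d : ℕ} (g : EuclideanSpace ℝ (Fin (d + 1)) ≃ₗᵢ[ℝ]
    EuclideanSpace ℝ (Fin (d + 1))) :
    MeasurePreserving (sphereIsometry g) (sphereMeasure d) (sphereMeasure d) := by
  have hm : Measurable (sphereIsometry g) := (sphereIsometry g).continuous.measurable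
  refine ⟨hm, Measure.ext fun s hs => ?_⟩
  rw [Measure.map_apply hm hs]
  simp only [sphereMeasure, Measure.smul_apply]
  congr 1
  rw [Measure.toSphere_apply' _ hs, Measure.toSphere_apply' _ (hm hs)]
  congr 1
  set A := Set.Ioo (0 : ℝ) 1 • (Subtype.val '' s : Set (EuclideanSpace ℝ (Fin (d + 1)))) with hA
  rw [← g.measurePreserving.measure_preimage_equiv (f := g.toHomeomorph.toMeasurableEquiv) A, hA]
  congr 1
  ext x
  simp only [Set.mem_smul, Set.mem_image, Set.mem_preimage, Subtype.exists]
  constructor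
  · rintro ⟨r, hr, _, ⟨y, hy, hys, rfl⟩, rfl⟩
    exact ⟨r, hr, g y, ⟨g y, by simpa using hy, hys, rfl⟩, (g.map_smul r y).symm⟩
  · rintro ⟨r, hr, _, ⟨y, hy, hys, rfl⟩, h⟩
    refine ⟨r, hr, g.symm y, ⟨g.symm y, by simpa using hy, ?_, rfl⟩, ?_⟩
    · simpa [sphereIsometry] using hys
    · apply g.injective
      simpa using h

/-- The integral over the sphere as a continuous linear functional. -/
noncomputable def sphereIntegral (d : ℕ) : C(UnitSphere d, ℝ) →L[ℝ] ℝ :=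
  LinearMap.mkContinuous
    { toFun := fun f => ∫ x, f x ∂(sphereMeasure d)
      map_add' := fun f g => integral_add (f.continuous.integrable_of_hasCompactSupport
        (HasCompactSupport.of_compactSpace _)) (g.continuous.integrable_of_hasCompactSupport
        (HasCompactSupport.of_compactSpace _))
      map_smul' := fun c f => integral_const_mul c _ } 1 fun f => by
    refine (norm_integral_le_of_norm_le_const (C := ‖f‖) (ae_of_all _ f.norm_coe_le_norm)).trans ?_
    simp

theorem sphereIntegral_apply (d : ℕ) (f : C(UnitSphere d, ℝ)) :
    sphereIntegral d f = ∫ x, f x ∂(sphereMeasure d) := rfl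

theorem sphereIntegral_comp {d : ℕ} (g : EuclideanSpace ℝ (Fin (d + 1)) ≃ₗᵢ[ℝ]
    EuclideanSpace ℝ (Fin (d + 1))) (f : C(UnitSphere d, ℝ)) :
    sphereIntegral d (f.comp (sphereIsometry g)) = sphereIntegral d f := by
  have h := measurePreserving_sphereIsometry g
  simp only [sphereIntegral_apply]
  conv_rhs => rw [← h.map_eq, integral_map h.measurable.aemeasurable
    f.continuous.aestronglyMeasurable]
  rfl

theorem sphereIntegral_nonneg {d : ℕ} {f : C(UnitSphere d, ℝ)} (hf : ∀ x, 0 ≤ f x) :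
    0 ≤ sphereIntegral d f := integral_nonneg hf

theorem sphereIntegral_one (d : ℕ) : sphereIntegral d 1 = 1 := by
  simp [sphereIntegral_apply]

/-! ### Orthogonality of harmonics of different degrees -/

open MvPolynomial in
theorem hasDerivAt_aeval {ι A : Type*} [Fintype ι] [NormedCommRing A] [NormedAlgebra ℝ A]
    {y : ℝ → ι → A} {y' : ι → A} {t : ℝ} (hy : ∀ l, HasDerivAt (fun s => y s l) (y' l) t)
    (p : MvPolynomial ι ℝ) :
    HasDerivAt (fun s => aeval (y s) p) (∑ l, aeval (y t) (pderiv l p) * y' l) t := by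
  classical
  induction p using MvPolynomial.induction_on with
  | C a => simpa using hasDerivAt_const t (algebraMap ℝ A a)
  | add p q hp hq =>
    simp only [map_add, add_mul, Finset.sum_add_distrib]
    exact hp.add hq
  | mul_X p i hp =>
    have := hp.mul (hy i)
    have e : (fun s => aeval (y s) (p * X i)) = (fun s => aeval (y s) p) * fun s => y s i := by
      ext s; simp
    rw [e]
    convert this using 1
    simp only [Derivation.leibniz, pderiv_X, Pi.single_apply, smul_eq_mul, map_add, map_mul,
      aeval_X, apply_ite (aeval (y t)), map_zero, mul_ite, ite_mul, mul_one, mul_zero,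
      add_mul, zero_mul, Finset.sum_add_distrib, Finset.sum_ite_eq, Finset.mem_univ, if_true,
      Finset.sum_mul]
    rw [add_comm]
    congr 1
    exact Finset.sum_congr rfl fun l _ => by ring

theorem reflection_apply_coord {n : ℕ} (u : EuclideanSpace ℝ (Fin n)) (hu : ‖u‖ = 1)
    (x : EuclideanSpace ℝ (Fin n)) (l : Fin n) :
    (ℝ ∙ u)ᗮ.reflection x l = x l - 2 * u l * ∑ m, u m * x m := by
  rw [Submodule.reflection_orthogonal_apply, Submodule.reflection_singleton_apply, hu]
  simp [PiLp.inner_apply, mul_comm, mul_assoc]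

open MvPolynomial in
theorem sphereRestrict_polyRefl {d : ℕ} (u : EuclideanSpace ℝ (Fin (d + 1))) (hu : ‖u‖ = 1)
    (p : MvPolynomial (Fin (d + 1)) ℝ) :
    sphereRestrict d (polyRefl u p) =
      (sphereRestrict d p).comp (sphereIsometry (ℝ ∙ u)ᗮ.reflection) := by
  ext x
  rw [ContinuousMap.comp_apply, sphereRestrict_apply, sphereRestrict_apply, eval_polyRefl]
  congr 2
  ext l
  exact (reflection_apply_coord u hu x l).symm

-- Reflect in the unit vector `u t = cos t eᵢ + sin t eⱼ`. The integral of the reflected `p` does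
-- not depend on `t`, and its derivative at `0` is twice the integral of the reflected `polyRot p`.
-- A second use of invariance removes the reflection, so reflections alone suffice.
open MvPolynomial in
theorem sphereIntegral_sphereRestrict_polyRot (d : ℕ) (i j : Fin (d + 1))
    (p : MvPolynomial (Fin (d + 1)) ℝ) :
    sphereIntegral d (sphereRestrict d (polyRot (d + 1) i j p)) = 0 := by
  by_cases hij : i = j
  · subst hij; simp [polyRot_apply]
  let u : ℝ → EuclideanSpace ℝ (Fin (d + 1)) := fun t =>
    EuclideanSpace.single i (Real.cos t) + EuclideanSpace.single j (Real.sin t)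
  have hu : ∀ t, ‖u t‖ = 1 := by
    intro t
    have h : ‖u t‖ * ‖u t‖ = 1 := by
      rw [norm_add_mul_self_real]
      simp [EuclideanSpace.inner_single_left, hij, ← pow_two]
    nlinarith [norm_nonneg (u t)]
  let y : ℝ → Fin (d + 1) → C(UnitSphere d, ℝ) := fun t l =>
    sphereCoord d l - (2 * u t l) • (Real.cos t • sphereCoord d i + Real.sin t • sphereCoord d j)
  have hcomp : ∀ t q, aeval (y t) q =
      (sphereRestrict d q).comp (sphereIsometry (ℝ ∙ u t)ᗮ.reflection) := by
    intro t q
    ext x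
    rw [aeval_continuousMap_apply, ContinuousMap.comp_apply, sphereRestrict_apply]
    congr 2
    ext l
    refine Eq.trans ?_ (reflection_apply_coord (u t) (hu t) x l).symm
    simp [y, u, sphereCoord, add_mul, Finset.sum_add_distrib]
    ring
  have hy' : ∀ l, HasDerivAt (fun s => y s l)
      ((-2 : ℝ) • ((if l = j then sphereCoord d i else 0) + if l = i then sphereCoord d j else 0))
      0 := by
    intro l
    have hcos : HasDerivAt Real.cos 0 0 := by simpa using Real.hasDerivAt_cos 0
    have hsin : HasDerivAt Real.sin 1 0 := by simpa using Real.hasDerivAt_sin 0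
    have hul : HasDerivAt (fun t => 2 * u t l) (if l = j then 2 else 0) 0 := by
      have e : (fun t => 2 * u t l) = fun t =>
          2 * ((if l = i then 1 else 0) * Real.cos t + (if l = j then 1 else 0) * Real.sin t) := by
        ext t; simp [u]
      rw [e]
      exact (((hcos.const_mul _).add (hsin.const_mul _)).const_mul 2).congr_deriv (by simp)
    refine ((hul.smul ((hcos.smul_const (sphereCoord d i)).add
      (hsin.smul_const (sphereCoord d j)))).const_sub (sphereCoord d l)).congr_deriv ?_
    ext x
    by_cases h1 : l = i
    · simp [u, h1, hij]
    · by_cases h2 : l = j <;> simp [u, h1, h2, Ne.symm hij]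
  have hd := (sphereIntegral d).hasFDerivAt.comp_hasDerivAt (0 : ℝ) (hasDerivAt_aeval hy' p)
  have hc : (sphereIntegral d ∘ fun s => aeval (y s) p) =
      fun _ => sphereIntegral d (sphereRestrict d p) := by
    ext t
    rw [Function.comp_apply, hcomp, sphereIntegral_comp]
  rw [hc] at hd
  have h0 := hd.unique (hasDerivAt_const _ _)
  -- At `t = 0` the reflection is in `eᵢ`: it flips the coordinate `i` and fixes the coordinate `j`.
  have hi : sphereCoord d i = - aeval (y 0) (X i : MvPolynomial (Fin (d + 1)) ℝ) := by
    ext x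
    simp [y, u]
    ring
  have hj : sphereCoord d j = aeval (y 0) (X j : MvPolynomial (Fin (d + 1)) ℝ) := by
    simp [y, u, Ne.symm hij]
  have e : ∑ l, aeval (y 0) (pderiv l p) * ((-2 : ℝ) • ((if l = j then sphereCoord d i else 0) +
      if l = i then sphereCoord d j else 0)) = (2 : ℝ) • aeval (y 0) (polyRot (d + 1) i j p) := by
    simp only [mul_smul_comm, ← Finset.smul_sum, mul_add, Finset.sum_add_distrib, mul_ite, mul_zero,
      Finset.sum_ite_eq', Finset.mem_univ, if_true]
    rw [hi, hj, polyRot_apply]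
    simp only [map_sub, map_mul, Algebra.smul_def, map_neg, map_ofNat]
    ring
  rw [e, map_smul, hcomp, sphereIntegral_comp] at h0
  simpa using h0

theorem sphereRestrict_mul (d : ℕ) (p q : MvPolynomial (Fin (d + 1)) ℝ) :
    sphereRestrict d (p * q) = sphereRestrict d p * sphereRestrict d q := by
  simp [sphereRestrict]

theorem sphereIntegral_polyRot_mul (d : ℕ) (i j : Fin (d + 1))
    (p q : MvPolynomial (Fin (d + 1)) ℝ) :
    sphereIntegral d (sphereRestrict d (polyRot (d + 1) i j p * q)) =
      - sphereIntegral d (sphereRestrict d (p * polyRot (d + 1) i j q)) := by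
  have := sphereIntegral_sphereRestrict_polyRot d i j (p * q)
  rw [Derivation.leibniz, map_add, map_add, smul_eq_mul, smul_eq_mul, mul_comm q] at this
  linarith

/-- Rotations are antisymmetric, so the sum of their squares is symmetric; `f` and `g` are
eigenvectors with eigenvalues `-2k(k+d-1)` and `-2l(l+d-1)`, which differ. -/
theorem sphereIntegral_mul_eq_zero {d k l : ℕ} (hd : 1 ≤ d) (hkl : k ≠ l)
    {f g : C(UnitSphere d, ℝ)} (hf : f ∈ sphericalHarmonics d k)
    (hg : g ∈ sphericalHarmonics d l) : sphereIntegral d (f * g) = 0 := by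
  obtain ⟨p, ⟨hp, hp'⟩, rfl⟩ := hf
  obtain ⟨q, ⟨hq, hq'⟩, rfl⟩ := hg
  have h : sphereIntegral d (sphereRestrict d
        ((∑ i, ∑ j, polyRot (d + 1) i j (polyRot (d + 1) i j p)) * q)) =
      sphereIntegral d (sphereRestrict d
        (p * ∑ i, ∑ j, polyRot (d + 1) i j (polyRot (d + 1) i j q))) := by
    simp only [Finset.sum_mul, Finset.mul_sum, map_sum, sphereIntegral_polyRot_mul, neg_neg]
  rw [sum_polyRot_polyRot hp hp', sum_polyRot_polyRot hq hq', smul_mul_assoc, mul_smul_comm,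
    map_smul, map_smul, map_smul, map_smul, sphereRestrict_mul, smul_eq_mul, smul_eq_mul,
    ← sub_eq_zero, ← sub_mul, mul_eq_zero] at h
  refine h.resolve_left fun h => hkl ?_
  push_cast at h
  have h2 : ((k : ℝ) - l) * (k + l + d - 1) = 0 := by linarith
  rcases mul_eq_zero.1 h2 with h3 | h3
  · exact_mod_cast sub_eq_zero.1 h3
  · have : k + l + d = 1 := by
      have : (k : ℝ) + l + d = 1 := by linarith
      exact_mod_cast this
    omega

/-! ### Pointwise bound for an orthonormal basis -/

theorem sphericalHarmonics_comp_reflection {d k : ℕ} {f : C(UnitSphere d, ℝ)}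
    (hf : f ∈ sphericalHarmonics d k) (u : EuclideanSpace ℝ (Fin (d + 1))) (hu : ‖u‖ = 1) :
    f.comp (sphereIsometry (ℝ ∙ u)ᗮ.reflection) ∈ sphericalHarmonics d k := by
  obtain ⟨p, ⟨hp, hp'⟩, rfl⟩ := hf
  refine ⟨polyRefl u p, ⟨polyRefl_isHomogeneous _ hp, ?_⟩, sphereRestrict_polyRefl u hu p⟩
  have hu' : ∑ i, u i ^ 2 = 1 := by
    rw [← EuclideanSpace.real_norm_sq_eq, hu, one_pow]
  rw [SetLike.mem_coe, LinearMap.mem_ker] at hp' ⊢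
  rw [polyLaplacian_polyRefl _ hu', hp', map_zero]

theorem sphereIntegral_sq_sum {d : ℕ} {ι : Type*} [Fintype ι] [DecidableEq ι]
    (S : ι → C(UnitSphere d, ℝ))
    (hS : ∀ i j, sphereIntegral d (S i * S j) = if i = j then 1 else 0) (c : ι → ℝ) :
    sphereIntegral d ((∑ i, c i • S i) * ∑ i, c i • S i) = ∑ i, c i ^ 2 := by
  simp [Finset.sum_mul_sum, map_sum, hS, pow_two]

/-- The sum `F x` is the best constant in `f(x)² ≤ F x ∫ f²` over the harmonics of degree `k`.
Reflections preserve this space and can exchange any two points, so `F` is constant, and its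
integral is the dimension. -/
theorem sum_sq_le_harmonicDim {d k : ℕ}
    (S : Module.Basis (Fin (harmonicDim d k)) ℝ (sphericalHarmonics d k))
    (hS : ∀ i j, sphereIntegral d ((S i : C(UnitSphere d, ℝ)) * (S j : C(UnitSphere d, ℝ))) =
      if i = j then 1 else 0) (x : UnitSphere d) :
    ∑ j, (S j : C(UnitSphere d, ℝ)) x ^ 2 ≤ harmonicDim d k := by
  let F : C(UnitSphere d, ℝ) := ∑ j, (S j : C(UnitSphere d, ℝ)) * (S j : C(UnitSphere d, ℝ))
  have hF : ∀ x, F x = ∑ j, (S j : C(UnitSphere d, ℝ)) x ^ 2 := fun x => by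
    simp [F, pow_two]
  have hF0 : ∀ x, 0 ≤ F x := fun x => by rw [hF]; positivity
  have hcs : ∀ f ∈ sphericalHarmonics d k, ∀ x, f x ^ 2 ≤ sphereIntegral d (f * f) * F x := by
    intro f hf x
    have e : f = ∑ j, S.repr ⟨f, hf⟩ j • (S j : C(UnitSphere d, ℝ)) := by
      conv_lhs => rw [show f = ((⟨f, hf⟩ : sphericalHarmonics d k) : C(UnitSphere d, ℝ)) from rfl,
        ← S.sum_repr ⟨f, hf⟩]
      simp only [Submodule.coe_sum, Submodule.coe_smul]
    rw [e, sphereIntegral_sq_sum _ hS, hF]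
    simp only [ContinuousMap.coe_sum, Finset.sum_apply, ContinuousMap.smul_apply, smul_eq_mul]
    exact Finset.sum_mul_sq_le_sq_mul_sq _ _ _
  have hrefl : ∀ u : EuclideanSpace ℝ (Fin (d + 1)), ‖u‖ = 1 → ∀ x,
      F (sphereIsometry (ℝ ∙ u)ᗮ.reflection x) ≤ F x := by
    intro u hu x
    set g := (ℝ ∙ u)ᗮ.reflection
    -- The extremal function at the reflected point; its value there and its squared L² norm both
    -- equal `F` there.
    let f : C(UnitSphere d, ℝ) :=
      ∑ j, (S j : C(UnitSphere d, ℝ)) (sphereIsometry g x) • (S j : C(UnitSphere d, ℝ))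
    have hf : f ∈ sphericalHarmonics d k :=
      Submodule.sum_mem _ fun j _ => Submodule.smul_mem _ _ (S j).2
    have h := hcs _ (sphericalHarmonics_comp_reflection hf u hu) x
    have h1 : (f.comp (sphereIsometry g)) x = F (sphereIsometry g x) := by
      simp [f, F]
    have h2 : sphereIntegral d (f.comp (sphereIsometry g) * f.comp (sphereIsometry g)) =
        F (sphereIsometry g x) := by
      rw [hF, ← sphereIntegral_sq_sum _ hS]
      exact sphereIntegral_comp g (f * f)
    rw [h1, h2, pow_two] at h
    rcases (hF0 (sphereIsometry g x)).eq_or_lt with h0 | h0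
    · rw [← h0]; exact hF0 x
    · exact le_of_mul_le_mul_left h h0
  have hconst : ∀ x y, F x ≤ F y := by
    intro x y
    by_cases hxy : y = x
    · rw [hxy]
    let v : EuclideanSpace ℝ (Fin (d + 1)) := y - x
    have hn : ‖v‖ ≠ 0 := by
      rwa [norm_ne_zero_iff, sub_ne_zero, Ne, ← Subtype.ext_iff]
    have h := hrefl (‖v‖⁻¹ • v) (by simp [norm_smul, hn]) y
    convert h
    refine Subtype.ext ?_
    change _ = (ℝ ∙ _)ᗮ.reflection (y : EuclideanSpace ℝ (Fin (d + 1)))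
    simp only [Submodule.span_singleton_smul_eq (IsUnit.mk0 _ (inv_ne_zero hn))]
    exact (Submodule.reflection_sub (by simp)).symm
  have h := sphereIntegral_nonneg (f := F - F x • 1) fun y => by simpa using hconst x y
  rw [map_sub, map_smul, sphereIntegral_one, map_sum] at h
  simp only [hS, if_true, Finset.sum_const, Finset.card_univ, Fintype.card_fin] at h
  rw [← hF]
  simpa using h

/-! ### The Hilbert space through its feature map -/

/-- A Hilbert space of features `Φ` for the kernel of a reproducing kernel Hilbert space `H`
contains a copy of `H`. -/
theorem RKHS.exists_feature_embedding {X H E : Type*} [NormedAddCommGroup H]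
    [InnerProductSpace ℝ H] [CompleteSpace H] [RKHS ℝ H X ℝ] [NormedAddCommGroup E]
    [InnerProductSpace ℝ E] [CompleteSpace E] (Φ : X → E)
    (hΦ : ∀ x y, inner ℝ (Φ x) (Φ y) = RKHS.kernel H x y 1) :
    ∃ T : H →L[ℝ] E, ‖T‖ ≤ 1 ∧ (∀ (f : H) (x : X), f x = inner ℝ (T f) (Φ x)) ∧
      ∀ (e : E) (x : X), (T.adjoint e) x = inner ℝ e (Φ x) := by
  let A : (X →₀ ℝ) →ₗ[ℝ] H := Finsupp.linearCombination ℝ fun x => RKHS.kerFun H x 1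
  let B : (X →₀ ℝ) →ₗ[ℝ] E := Finsupp.linearCombination ℝ Φ
  have hin : ∀ x y, inner ℝ (RKHS.kerFun H x 1) (RKHS.kerFun H y 1) = inner ℝ (Φ x) (Φ y) := by
    intro x y
    rw [RKHS.kerFun_inner, RKHS.kerFun_apply, hΦ]
    simp
  -- Kernel sections and features have the same Gram matrix, so `A a ↦ B a` is well defined and
  -- isometric; it extends by density of the span of the sections.
  have hAB : ∀ a, ‖B a‖ ≤ 1 * ‖A a‖ := by
    intro a
    rw [one_mul]
    refine le_of_eq ((sq_eq_sq₀ (norm_nonneg _) (norm_nonneg _)).1 ?_)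
    rw [← real_inner_self_eq_norm_sq, ← real_inner_self_eq_norm_sq]
    simp only [A, B, Finsupp.linearCombination_apply, Finsupp.sum, sum_inner, inner_sum,
      real_inner_smul_left, real_inner_smul_right, hin]
  have hd : DenseRange A := by
    have h := RKHS.kerFun_dense H
    rw [← Submodule.dense_iff_topologicalClosure_eq_top] at h
    have e : (Submodule.span ℝ {y | ∃ x v, RKHS.kerFun H x v = y}) ≤ LinearMap.range A := by
      rw [Submodule.span_le]
      rintro _ ⟨x, v, rfl⟩
      refine ⟨Finsupp.single x v, ?_⟩
      rw [Finsupp.linearCombination_single, ← map_smul, smul_eq_mul, mul_one]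
    exact h.mono e
  let T := B.extendOfNorm A
  have hT : ∀ x, T (RKHS.kerFun H x 1) = Φ x := by
    intro x
    have := LinearMap.extendOfNorm_eq hd ⟨1, hAB⟩ (Finsupp.single x 1)
    simpa [A, B] using this
  refine ⟨T, LinearMap.opNorm_extendOfNorm_le hd zero_le_one hAB, fun f x => ?_, fun e x => ?_⟩
  · refine hd.induction_on (p := fun f => f x = inner ℝ (T f) (Φ x)) f ?_ ?_
    · exact isClosed_eq (RKHS.continuous_eval x) (by fun_prop)
    · intro a
      have h1 : A a x = inner ℝ (A a) (RKHS.kerFun H x 1) := by simp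
      have h2 : T (A a) = B a := LinearMap.extendOfNorm_eq hd ⟨1, hAB⟩ a
      rw [h1, h2]
      simp only [A, B, Finsupp.linearCombination_apply, Finsupp.sum, sum_inner,
        real_inner_smul_left, hin]
  · have h1 : (T.adjoint e) x = inner ℝ (T.adjoint e) (RKHS.kerFun H x 1) := by simp
    rw [h1, ContinuousLinearMap.adjoint_inner_left, hT]

theorem exists_geometric_bound_harmonicDim (d : ℕ) {δ r : ℝ} (hδ : 0 < δ) (hr : δ < r) :
    ∃ C : ℝ, 0 < C ∧ ∀ k, δ ^ k * harmonicDim d k ≤ C * r ^ k := by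
  have hr0 : 0 < r := hδ.trans hr
  have hq : |δ / r| < 1 := by
    rw [abs_of_pos (by positivity), div_lt_one hr0]; exact hr
  have ht := (tendsto_pow_const_mul_const_pow_of_abs_lt_one d hq).comp (tendsto_add_atTop_nat d)
  obtain ⟨C, hC⟩ := ht.bddAbove_range
  have hC' : ∀ k : ℕ, ((k + d : ℕ) : ℝ) ^ d * (δ / r) ^ (k + d) ≤ C := fun k => hC ⟨k, rfl⟩
  have hqd : 0 < (δ / r) ^ d := by positivity
  refine ⟨(|C| + 1) / (δ / r) ^ d, by positivity, fun k => ?_⟩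
  have h1 : (harmonicDim d k : ℝ) ≤ ((k + d : ℕ) : ℝ) ^ d := by
    exact_mod_cast (harmonicDim_le d k).trans (Nat.choose_le_pow _ _)
  calc δ ^ k * harmonicDim d k ≤ δ ^ k * ((k + d : ℕ) : ℝ) ^ d := by gcongr
    _ = ((k + d : ℕ) : ℝ) ^ d * (δ / r) ^ (k + d) / (δ / r) ^ d * r ^ k := by
      rw [pow_add, div_pow δ r k]; field_simp
    _ ≤ (|C| + 1) / (δ / r) ^ d * r ^ k := by
      gcongr
      exact (hC' k).trans ((le_abs_self C).trans (by linarith))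

theorem summable_sqrt_harmonicDim (d : ℕ) {δ : ℝ} (hδ : 0 < δ) (hδ1 : δ < 1) :
    Summable fun k => √(δ ^ k * harmonicDim d k) := by
  obtain ⟨r, hr, hr1⟩ := exists_between hδ1
  obtain ⟨C, hC, h⟩ := exists_geometric_bound_harmonicDim d hδ hr
  have hr0 : 0 ≤ r := (hδ.trans hr).le
  refine Summable.of_nonneg_of_le (fun _ => Real.sqrt_nonneg _)
    (fun k => Real.sqrt_le_sqrt (h k)) ?_
  have : ∀ k, √(C * r ^ k) = √C * √r ^ k := fun k => by
    rw [Real.sqrt_mul hC.le]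
    congr 1
    rw [Real.sqrt_eq_iff_mul_self_eq (by positivity) (by positivity), ← mul_pow,
      Real.mul_self_sqrt hr0]
  simp only [this]
  refine (summable_geometric_of_lt_one (Real.sqrt_nonneg _) ?_).mul_left _
  rw [Real.sqrt_lt' one_pos]
  simpa using hr1

theorem EuclideanSpace.real_inner_toLp_right {ι : Type*} [Fintype ι] (c : EuclideanSpace ℝ ι)
    (v : ι → ℝ) : inner ℝ c (WithLp.toLp 2 v) = ∑ i, c i * v i := by
  simp [PiLp.inner_apply, mul_comm]

/-- The degree `k` component of the feature map of the Gaussian type kernel. -/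
noncomputable def harmonicFeature {d : ℕ} (δ : ℝ)
    (S : (k : ℕ) → Module.Basis (Fin (harmonicDim d k)) ℝ (sphericalHarmonics d k))
    (x : UnitSphere d) (k : ℕ) : EuclideanSpace ℝ (Fin (harmonicDim d k)) :=
  √(δ ^ k) • WithLp.toLp 2 fun j => (S k j : C(UnitSphere d, ℝ)) x

section

variable {d : ℕ} {δ : ℝ}
  {S : (k : ℕ) → Module.Basis (Fin (harmonicDim d k)) ℝ (sphericalHarmonics d k)}

theorem inner_harmonicFeature_right (x : UnitSphere d) (k : ℕ)
    (c : EuclideanSpace ℝ (Fin (harmonicDim d k))) :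
    inner ℝ c (harmonicFeature δ S x k) =
      (√(δ ^ k) • ∑ j, c j • (S k j : C(UnitSphere d, ℝ))) x := by
  rw [harmonicFeature, real_inner_smul_right, EuclideanSpace.real_inner_toLp_right]
  simp

theorem inner_harmonicFeature (hδ : 0 < δ) (x y : UnitSphere d) (k : ℕ) :
    inner ℝ (harmonicFeature δ S x k) (harmonicFeature δ S y k) =
      δ ^ k * ∑ j, (S k j : C(UnitSphere d, ℝ)) x * (S k j : C(UnitSphere d, ℝ)) y := by
  rw [inner_harmonicFeature_right]
  simp only [harmonicFeature, ContinuousMap.smul_apply, ContinuousMap.coe_sum, Finset.sum_apply,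
    PiLp.smul_apply, smul_eq_mul, Finset.mul_sum]
  refine Finset.sum_congr rfl fun j _ => ?_
  nth_rw 3 [← Real.mul_self_sqrt (pow_nonneg hδ.le k)]
  ring

theorem norm_harmonicFeature_le (hδ : 0 < δ)
    (hS : ∀ k i j, sphereIntegral d ((S k i : C(UnitSphere d, ℝ)) * (S k j : C(UnitSphere d, ℝ))) =
      if i = j then 1 else 0) (x : UnitSphere d) (k : ℕ) :
    ‖harmonicFeature δ S x k‖ ≤ √(δ ^ k * harmonicDim d k) := by
  refine Real.le_sqrt_of_sq_le ?_
  rw [← real_inner_self_eq_norm_sq, inner_harmonicFeature hδ]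
  gcongr
  simpa [pow_two] using sum_sq_le_harmonicDim (S k) (hS k) x

theorem exists_harmonic_feature_embedding (hδ : 0 < δ)
    {H : Type*} [NormedAddCommGroup H] [InnerProductSpace ℝ H] [CompleteSpace H]
    [RKHS ℝ H (UnitSphere d) ℝ]
    (hK : ∀ x y, HasSum (fun k : ℕ => δ ^ k * ∑ j, (S k j : C(UnitSphere d, ℝ)) x *
      (S k j : C(UnitSphere d, ℝ)) y) (RKHS.kernel H x y 1)) :
    ∃ T : H →L[ℝ] lp (fun k => EuclideanSpace ℝ (Fin (harmonicDim d k))) 2, ‖T‖ ≤ 1 ∧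
      (∀ (f : H) x, HasSum (fun k => inner ℝ (T f k) (harmonicFeature δ S x k)) (f x)) ∧
      ∀ e x, HasSum (fun k => inner ℝ (e k) (harmonicFeature δ S x k)) ((T.adjoint e) x) := by
  simp only [← inner_harmonicFeature hδ] at hK
  have hmem : ∀ x, Memℓp (harmonicFeature δ S x) 2 := by
    intro x
    refine memℓp_gen ?_
    have := (hK x x).summable
    simp only [real_inner_self_eq_norm_sq] at this
    simpa using this
  let Φ : UnitSphere d → lp (fun k => EuclideanSpace ℝ (Fin (harmonicDim d k))) 2 :=
    fun x => ⟨harmonicFeature δ S x, hmem x⟩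
  obtain ⟨T, hT1, hT, hTa⟩ := RKHS.exists_feature_embedding (H := H) Φ fun x y => by
    rw [lp.inner_eq_tsum, ← (hK x y).tsum_eq]
  refine ⟨T, hT1, fun f x => ?_, fun e x => ?_⟩
  · rw [hT]; exact lp.hasSum_inner (T f) (Φ x)
  · rw [hTa]; exact lp.hasSum_inner e (Φ x)

/-- The feature embedding `T` is a contraction, which bounds the degree `k` parts and serves the
upper bound. Its adjoint, also a contraction, realizes every coefficient vector of norm at most 1 by
a function in the unit ball, which serves the lower bound. -/
theorem exists_embedding (hδ : 0 < δ) (hδ1 : δ < 1)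
    {H : Type*} [NormedAddCommGroup H] [InnerProductSpace ℝ H] [CompleteSpace H]
    [RKHS ℝ H (UnitSphere d) ℝ]
    (hS : ∀ k i j, sphereIntegral d ((S k i : C(UnitSphere d, ℝ)) * (S k j : C(UnitSphere d, ℝ))) =
      if i = j then 1 else 0)
    (hK : ∀ x y, HasSum (fun k : ℕ => δ ^ k * ∑ j, (S k j : C(UnitSphere d, ℝ)) x *
      (S k j : C(UnitSphere d, ℝ)) y) (RKHS.kernel H x y 1)) :
    ∃ I : H →L[ℝ] C(UnitSphere d, ℝ), (∀ (f : H) (x : UnitSphere d), I f x = f x) ∧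
      (∀ f : H, ‖f‖ ≤ 1 → ∃ h : ℕ → C(UnitSphere d, ℝ), (∀ k, h k ∈ sphericalHarmonics d k) ∧
        (∀ k, ‖h k‖ ≤ √(δ ^ k * harmonicDim d k)) ∧ HasSum h (I f)) ∧
      ∀ (N : ℕ) (c : (k : ℕ) → EuclideanSpace ℝ (Fin (harmonicDim d k))),
        ∑ k ∈ Finset.range (N + 1), ‖c k‖ ^ 2 ≤ δ ^ N → ∃ f : H, ‖f‖ ≤ 1 ∧
          I f = ∑ k ∈ Finset.range (N + 1), ∑ j, c k j • (S k j : C(UnitSphere d, ℝ)) := by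
  obtain ⟨T, hT1, hT, hTa⟩ := exists_harmonic_feature_embedding hδ hK
  have hTn : ∀ f, ‖T f‖ ≤ ‖f‖ := fun f => by
    simpa using T.le_of_opNorm_le hT1 f
  let h : H → ℕ → C(UnitSphere d, ℝ) := fun f k =>
    √(δ ^ k) • ∑ j, T f k j • (S k j : C(UnitSphere d, ℝ))
  have hx : ∀ f k x, h f k x = inner ℝ (T f k) (harmonicFeature δ S x k) :=
    fun f k x => (inner_harmonicFeature_right x k _).symm
  have hn : ∀ f k, ‖h f k‖ ≤ √(δ ^ k * harmonicDim d k) * ‖f‖ := by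
    intro f k
    rw [ContinuousMap.norm_le _ (by positivity)]
    intro x
    rw [hx, mul_comm]
    refine (norm_inner_le_norm _ _).trans ?_
    gcongr
    · exact (lp.norm_apply_le_norm (by simp) (T f) k).trans (hTn f)
    · exact norm_harmonicFeature_le hδ hS x k
  have hq := summable_sqrt_harmonicDim d hδ hδ1
  have hs : ∀ f, Summable (h f) := fun f =>
    Summable.of_norm_bounded (hq.mul_right ‖f‖) (hn f)
  have hsum : ∀ f x, (∑' k, h f k) x = f x := by
    intro f x
    refine (ContinuousMap.hasSum_apply (hs f).hasSum x).unique ?_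
    simp only [hx]
    exact hT f x
  let I : H →L[ℝ] C(UnitSphere d, ℝ) := LinearMap.mkContinuous
    { toFun := fun f => ∑' k, h f k
      map_add' := fun f g => by ext x; simp [hsum]
      map_smul' := fun c f => by ext x; simp [hsum] } (∑' k, √(δ ^ k * harmonicDim d k))
    fun f => tsum_of_norm_bounded (hq.hasSum.mul_right ‖f‖) (hn f)
  have hI : ∀ f x, I f x = f x := hsum
  refine ⟨I, hI, fun f hf => ⟨h f, fun k => ?_, fun k => ?_, (hs f).hasSum⟩, fun N c hc => ?_⟩
  · exact Submodule.smul_mem _ _ <|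
      Submodule.sum_mem _ fun j _ => Submodule.smul_mem _ _ (S k j).2
  · exact (hn f k).trans (mul_le_of_le_one_right (Real.sqrt_nonneg _) hf)
  -- Dividing by the weights `δ^{k/2} ≥ δ^{N/2}` keeps the vector in the unit ball, thanks to the
  -- radius `δ^{N/2}` allowed for `c`.
  · let e : lp (fun k => EuclideanSpace ℝ (Fin (harmonicDim d k))) 2 :=
      ∑ k ∈ Finset.range (N + 1), lp.single 2 k ((√(δ ^ k))⁻¹ • c k)
    have hek : ∀ k, e k = if k ∈ Finset.range (N + 1) then (√(δ ^ k))⁻¹ • c k else 0 := by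
      intro k
      simp only [e, lp.coeFn_sum, lp.coeFn_single, Finset.sum_apply, Finset.sum_pi_single]
    have he : ‖e‖ ≤ 1 := by
      have h2 := lp.norm_sum_single (p := 2) (by simp) (fun k => (√(δ ^ k))⁻¹ • c k)
        (Finset.range (N + 1))
      simp only [ENNReal.toReal_ofNat, Real.rpow_ofNat] at h2
      refine (sq_le_one_iff₀ (norm_nonneg _)).1 (h2.le.trans ?_)
      calc ∑ k ∈ Finset.range (N + 1), ‖(√(δ ^ k))⁻¹ • c k‖ ^ 2
          ≤ ∑ k ∈ Finset.range (N + 1), (δ ^ N)⁻¹ * ‖c k‖ ^ 2 := by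
            refine Finset.sum_le_sum fun k hk => ?_
            rw [norm_smul, mul_pow, norm_inv, Real.norm_of_nonneg (Real.sqrt_nonneg _), inv_pow,
              Real.sq_sqrt (pow_nonneg hδ.le k)]
            gcongr ?_⁻¹ * _
            exact pow_le_pow_of_le_one hδ.le hδ1.le (Nat.lt_succ_iff.1 (Finset.mem_range.1 hk))
        _ = (δ ^ N)⁻¹ * ∑ k ∈ Finset.range (N + 1), ‖c k‖ ^ 2 := by rw [Finset.mul_sum]
        _ ≤ (δ ^ N)⁻¹ * δ ^ N := by gcongr
        _ = 1 := inv_mul_cancel₀ (by positivity)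
    refine ⟨T.adjoint e, ?_, ?_⟩
    · refine (T.adjoint.le_of_opNorm_le (c := 1) (by simpa using hT1) e).trans (by simpa using he)
    · ext x
      rw [hI]
      refine (hTa e x).unique ?_
      have hs := hasSum_sum_of_ne_finset_zero (s := Finset.range (N + 1))
        (f := fun k => inner ℝ (e k) (harmonicFeature δ S x k)) (L := .unconditional ℕ)
        fun k hk => by rw [hek, if_neg hk, inner_zero_left]
      convert hs using 1
      · rw [ContinuousMap.coe_sum, Finset.sum_apply]
        refine Finset.sum_congr rfl fun k hk => ?_
        have h0 : √(δ ^ k) ≠ 0 := by positivity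
        rw [hek, if_pos hk, inner_harmonicFeature_right]
        simp only [PiLp.smul_apply, smul_assoc, ← Finset.smul_sum]
        rw [smul_inv_smul₀ h0]

end

/-! ### Covering numbers by volume comparison -/

-- The balls of radius `η/2` about the points are disjoint and lie in the ball of radius `R + η/2`.
open Metric in
theorem card_le_of_isSeparated {F : Type*} [NormedAddCommGroup F] [NormedSpace ℝ F]
    [FiniteDimensional ℝ F] {R η : ℝ} (hR : 0 ≤ R) (hη : 0 < η) (s : Finset F)
    (hs : ∀ x ∈ s, ‖x‖ ≤ R) (hsep : ∀ x ∈ s, ∀ y ∈ s, x ≠ y → η ≤ dist x y) :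
    (s.card : ℝ) ≤ (1 + 2 * R / η) ^ Module.finrank ℝ F := by
  borelize F
  let μ : Measure F := Measure.addHaar
  have hdisj : (s : Set F).PairwiseDisjoint fun x => ball x (η / 2) := by
    intro x hx y hy hxy
    refine ball_disjoint_ball ?_
    linarith [hsep x hx y hy hxy]
  have hsub : (⋃ x ∈ s, ball x (η / 2)) ⊆ ball (0 : F) (R + η / 2) := by
    refine Set.iUnion₂_subset fun x hx => ball_subset_ball' ?_
    rw [dist_zero_right]
    linarith [hs x hx]
  have hμ := measureReal_mono (μ := μ) hsub measure_ball_lt_top.ne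
  rw [measureReal_biUnion_finset hdisj (fun _ _ => measurableSet_ball)
    fun _ _ => measure_ball_lt_top.ne] at hμ
  have hball : ∀ (x : F) {r : ℝ}, 0 < r →
      μ.real (ball x r) = r ^ Module.finrank ℝ F * μ.real (ball 0 1) := by
    intro x r hr
    rw [measureReal_def, μ.addHaar_ball_of_pos x hr, ENNReal.toReal_mul,
      ENNReal.toReal_ofReal (by positivity)]
    rfl
  rw [hball 0 (by positivity)] at hμ
  simp only [hball _ (half_pos hη), Finset.sum_const, nsmul_eq_mul, ← mul_assoc] at hμ
  have hpos : 0 < μ.real (ball (0 : F) 1) :=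
    ENNReal.toReal_pos (measure_ball_pos μ 0 one_pos).ne' measure_ball_lt_top.ne
  have h := le_of_mul_le_mul_right hμ hpos
  have e : 1 + 2 * R / η = (R + η / 2) / (η / 2) := by field_simp; ring
  rwa [e, div_pow, le_div_iff₀ (by positivity)]

open Metric in
theorem packingNumber_closedBall_le {F : Type*} [NormedAddCommGroup F] [NormedSpace ℝ F]
    [FiniteDimensional ℝ F] {R η : ℝ} (hR : 0 ≤ R) (hη : 0 < η) :
    packingNumber η.toNNReal (closedBall (0 : F) R) ≤
      (⌊(1 + 2 * R / η) ^ Module.finrank ℝ F⌋₊ : ℕ) := by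
  refine iSup_le fun C => iSup_le fun hC => iSup_le fun hsep => ?_
  by_contra! hlt
  obtain ⟨t, htC, ht⟩ := Set.exists_subset_encard_eq (Order.add_one_le_of_lt hlt)
  have htfin : t.Finite := Set.finite_of_encard_eq_coe (k := ⌊(1 + 2 * R / η) ^ Module.finrank ℝ F⌋₊ + 1)
    (by rw [ht]; rfl)
  have h := card_le_of_isSeparated hR hη htfin.toFinset (fun x hx => by
      simpa using hC (htC (htfin.mem_toFinset.1 hx))) (fun x hx y hy hxy => by
      have := hsep (htC (htfin.mem_toFinset.1 hx)) (htC (htfin.mem_toFinset.1 hy)) hxy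
      change ENNReal.ofReal η < edist x y at this
      rw [edist_dist] at this
      exact ((ENNReal.ofReal_lt_ofReal_iff_of_nonneg hη.le).1 this).le)
  have h2 := Nat.le_floor h
  rw [htfin.encard_eq_coe_toFinset_card] at ht
  have h3 : htfin.toFinset.card = ⌊(1 + 2 * R / η) ^ Module.finrank ℝ F⌋₊ + 1 := by
    exact_mod_cast ht
  omega

-- Half of `ε` is spent on the approximation and half on a net of the ball of radius `R` in `V`.
open Metric in
theorem externalCoveringNumber_le_of_approx {Y : Type*} [NormedAddCommGroup Y] [NormedSpace ℝ Y]
    (A : Set Y) (V : Submodule ℝ Y) [FiniteDimensional ℝ V] {R ε : ℝ} (hR : 0 ≤ R) (hε : 0 < ε)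
    (h : ∀ a ∈ A, ∃ v ∈ V, ‖v‖ ≤ R ∧ ‖a - v‖ ≤ ε / 2) :
    externalCoveringNumber ε.toNNReal A ≤ (⌊(1 + 4 * R / ε) ^ Module.finrank ℝ V⌋₊ : ℕ) := by
  have hp := (coveringNumber_le_packingNumber _ _).trans
    (packingNumber_closedBall_le (F := V) hR (half_pos hε))
  obtain ⟨C, -, -, hC, hCn⟩ := exists_set_encard_eq_coveringNumber
    (hp.trans_lt (ENat.natCast_lt_top _)).ne
  have e : 4 * R / ε = 2 * R / (ε / 2) := by field_simp; ring
  rw [e]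
  refine le_trans (IsCover.externalCoveringNumber_le_encard (C := Subtype.val '' C) ?_)
    ((Set.encard_image_le _ _).trans (hCn.le.trans hp))
  intro a ha
  obtain ⟨v, hv, hvR, hav⟩ := h a ha
  obtain ⟨c, hc, hvc⟩ := hC (show (⟨v, hv⟩ : V) ∈ closedBall (0 : V) R by simpa using hvR)
  refine ⟨c, ⟨c, hc, rfl⟩, ?_⟩
  change edist a c ≤ ENNReal.ofReal ε
  change edist (⟨v, hv⟩ : V) c ≤ ENNReal.ofReal (ε / 2) at hvc
  rw [edist_dist, ENNReal.ofReal_le_ofReal_iff (by positivity)] at hvc ⊢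
  change dist v c ≤ ε / 2 at hvc
  rw [← dist_eq_norm] at hav
  linarith [dist_triangle a v c]

-- Since `A` does not shrink distances, the preimage of an `ε`-ball has diameter at most `2ε`. It
-- therefore lies in a `2ε`-ball about one of its points; the centre in `Y` need not be in the range
-- of `A`, whence the factor 2. Then volumes are compared in `F`.
open Metric in
theorem pow_le_externalCoveringNumber_mul_pow {F Y : Type*} [NormedAddCommGroup F]
    [NormedSpace ℝ F] [FiniteDimensional ℝ F] [NormedAddCommGroup Y] [NormedSpace ℝ Y]
    (A : F →ₗ[ℝ] Y) (hA : ∀ c, ‖c‖ ≤ ‖A c‖) (B : Set Y) {r ε : ℝ} (hr : 0 < r) (hε : 0 < ε)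
    (hB : ∀ c, ‖c‖ ≤ r → A c ∈ B) (hfin : externalCoveringNumber ε.toNNReal B ≠ ⊤) :
    r ^ Module.finrank ℝ F ≤
      (externalCoveringNumber ε.toNNReal B).toNat * (2 * ε) ^ Module.finrank ℝ F := by
  borelize F
  let μ : Measure F := Measure.addHaar
  set n := (externalCoveringNumber ε.toNNReal B).toNat with hn
  have hlt : externalCoveringNumber ε.toNNReal B < (n + 1 : ℕ) := by
    rw [← ENat.natCast_toNat hfin]
    exact_mod_cast Nat.lt_succ_self n
  simp only [externalCoveringNumber, iInf_lt_iff] at hlt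
  obtain ⟨C, hC, hCn⟩ := hlt
  have hCfin : C.Finite := Set.encard_lt_top_iff.1 (hCn.trans (ENat.natCast_lt_top _))
  have hcard : hCfin.toFinset.card ≤ n := by
    rw [hCfin.encard_eq_coe_toFinset_card] at hCn
    have : hCfin.toFinset.card < n + 1 := by exact_mod_cast hCn
    omega
  have hx : ∀ y : Y, ∃ x : F, ∀ c, dist (A c) y ≤ ε → dist c x ≤ 2 * ε := by
    intro y
    by_cases h : ∃ x, dist (A x) y ≤ ε
    · obtain ⟨x, hx⟩ := h
      refine ⟨x, fun c hc => ?_⟩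
      have h1 := hA (c - x)
      rw [map_sub, ← dist_eq_norm, ← dist_eq_norm] at h1
      linarith [dist_triangle_right (A c) (A x) y]
    · exact ⟨0, fun c hc => (h ⟨c, hc⟩).elim⟩
  choose x hx using hx
  have hsub : closedBall (0 : F) r ⊆ ⋃ y ∈ hCfin.toFinset, closedBall (x y) (2 * ε) := by
    intro c hc
    obtain ⟨y, hy, hcy⟩ := hC (hB c (by simpa using hc))
    change edist (A c) y ≤ ENNReal.ofReal ε at hcy
    rw [edist_dist, ENNReal.ofReal_le_ofReal_iff hε.le] at hcy
    exact Set.mem_biUnion (hCfin.mem_toFinset.2 hy) (hx y c hcy)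
  have hμ := (measureReal_mono (μ := μ) hsub
    (measure_biUnion_lt_top hCfin.toFinset.finite_toSet fun _ _ => measure_closedBall_lt_top).ne).trans
    (measureReal_biUnion_finset_le _ _)
  simp only [μ.addHaar_real_closedBall _ hr.le,
    μ.addHaar_real_closedBall _ (show 0 ≤ 2 * ε by positivity), Finset.sum_const, nsmul_eq_mul,
    ← mul_assoc] at hμ
  have hpos : 0 < μ.real (ball (0 : F) 1) :=
    ENNReal.toReal_pos (measure_ball_pos μ 0 one_pos).ne' measure_ball_lt_top.ne
  refine (le_of_mul_le_mul_right hμ hpos).trans ?_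
  gcongr

/-! ### Polynomial approximation on the sphere -/

open MvPolynomial in
/-- The restrictions to the sphere of the homogeneous polynomials of degree `k`. -/
noncomputable def sphereHomogeneous (d k : ℕ) : Submodule ℝ C(UnitSphere d, ℝ) :=
  (homogeneousSubmodule (Fin (d + 1)) ℝ k).map (sphereRestrict d)

open MvPolynomial in
instance finiteDimensional_homogeneousSubmodule (n k : ℕ) :
    FiniteDimensional ℝ (homogeneousSubmodule (Fin n) ℝ k) :=
  Module.Finite.iff_fg.2 (homogeneousSubmodule_fg (R := ℝ) (σ := Fin n) k)

instance finiteDimensional_sphereHomogeneous (d k : ℕ) :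
    FiniteDimensional ℝ (sphereHomogeneous d k) := by
  unfold sphereHomogeneous; infer_instance

theorem finrank_sphereHomogeneous_le (d k : ℕ) :
    Module.finrank ℝ (sphereHomogeneous d k) ≤ (k + d).choose d := by
  rw [← finrank_homogeneousSubmodule_fin]
  exact Submodule.finrank_map_le _ _

-- Multiplication by `∑ xᵢ²`, which is 1 on the sphere. Thus two consecutive degrees capture all
-- lower ones.
open MvPolynomial in
theorem sphereHomogeneous_le_add_two (d k : ℕ) :
    sphereHomogeneous d k ≤ sphereHomogeneous d (k + 2) := by
  rintro _ ⟨p, hp, rfl⟩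
  refine ⟨p * ∑ i, X i ^ 2, IsHomogeneous.mul hp (IsHomogeneous.sum _ _ _ fun i _ =>
    isHomogeneous_X_pow i 2), ?_⟩
  ext x
  have hx : ∑ i, (x : EuclideanSpace ℝ (Fin (d + 1))) i ^ 2 = 1 := by
    rw [← EuclideanSpace.real_norm_sq_eq, norm_eq_of_mem_sphere, one_pow]
  rw [sphereRestrict_mul, ContinuousMap.mul_apply, sphereRestrict_apply d (∑ i, X i ^ 2)]
  simp [hx]

/-- The restrictions to the sphere of the polynomials of degree at most `N + 1`. -/
noncomputable def spherePoly (d N : ℕ) : Submodule ℝ C(UnitSphere d, ℝ) :=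
  sphereHomogeneous d N ⊔ sphereHomogeneous d (N + 1)

instance finiteDimensional_spherePoly (d N : ℕ) : FiniteDimensional ℝ (spherePoly d N) := by
  unfold spherePoly; infer_instance

theorem spherePoly_mono (d : ℕ) : Monotone (spherePoly d) :=
  monotone_nat_of_le_succ fun N =>
    sup_le ((sphereHomogeneous_le_add_two d N).trans le_sup_right) le_sup_left

theorem sphericalHarmonics_le_spherePoly {d k N : ℕ} (h : k ≤ N) :
    sphericalHarmonics d k ≤ spherePoly d N :=
  ((Submodule.map_mono inf_le_left).trans le_sup_left).trans (spherePoly_mono d h)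

theorem finrank_spherePoly_le (d N : ℕ) :
    (Module.finrank ℝ (spherePoly d N) : ℝ) ≤ 2 / d.factorial * (N + 1 + d : ℝ) ^ d := by
  have h1 : Module.finrank ℝ (spherePoly d N) ≤ (N + d).choose d + (N + 1 + d).choose d :=
    (Submodule.finrank_add_le_finrank_add_finrank _ _).trans
      (add_le_add (finrank_sphereHomogeneous_le d N) (finrank_sphereHomogeneous_le d (N + 1)))
  have h2 : (N + d).choose d ≤ (N + 1 + d).choose d := Nat.choose_le_choose _ (by omega)
  have h3 : ((N + 1 + d).choose d : ℝ) ≤ ((N + 1 + d : ℕ) : ℝ) ^ d / d.factorial :=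
    Nat.choose_le_pow_div d (N + 1 + d)
  calc (Module.finrank ℝ (spherePoly d N) : ℝ) ≤ 2 * ((N + 1 + d).choose d : ℝ) := by
        exact_mod_cast (by omega)
    _ ≤ 2 * (((N + 1 + d : ℕ) : ℝ) ^ d / d.factorial) := by gcongr
    _ = _ := by push_cast; ring

theorem exists_approx_of_hasSum {d : ℕ} {C ρ : ℝ} (hC : 0 ≤ C) (hρ : 0 ≤ ρ) (hρ1 : ρ < 1)
    {h : ℕ → C(UnitSphere d, ℝ)} {f : C(UnitSphere d, ℝ)}
    (hh : ∀ k, h k ∈ sphericalHarmonics d k) (hn : ∀ k, ‖h k‖ ≤ C * ρ ^ k) (hf : HasSum h f)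
    (N : ℕ) : ∃ v ∈ spherePoly d N, ‖v‖ ≤ C / (1 - ρ) ∧ ‖f - v‖ ≤ C / (1 - ρ) * ρ ^ N := by
  have hg := hasSum_geometric_of_lt_one hρ hρ1
  refine ⟨∑ k ∈ Finset.range N, h k, Submodule.sum_mem _ fun k hk =>
    sphericalHarmonics_le_spherePoly (Finset.mem_range.1 hk).le (hh k), ?_, ?_⟩
  · rw [div_eq_mul_inv]
    refine (norm_sum_le_of_le _ fun k _ => hn k).trans ?_
    exact sum_le_hasSum _ (fun k _ => by positivity) (hg.mul_left C)
  · have h1 := (hasSum_nat_add_iff' N).2 hf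
    rw [← h1.tsum_eq]
    refine tsum_of_norm_bounded (g := fun k => C * ρ ^ N * ρ ^ k) ?_ fun k => ?_
    · rw [div_eq_mul_inv, mul_right_comm]
      exact hg.mul_left (C * ρ ^ N)
    · refine (hn _).trans (le_of_eq ?_)
      rw [pow_add]; ring

/-! ### Asymptotics of the entropy -/

theorem tendsto_pow_mul_div_pow (d : ℕ) (a b c e : ℝ) :
    Tendsto (fun L : ℝ => (a * L + b) ^ d * (c * L + e) / (2 * L) ^ (d + 1)) atTop
      (𝓝 (a ^ d * c / 2 ^ (d + 1))) := by
  have h : Tendsto (fun L : ℝ => (a + b / L) ^ d * (c + e / L) / 2 ^ (d + 1)) atTop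
      (𝓝 ((a + 0) ^ d * (c + 0) / 2 ^ (d + 1))) :=
    ((((tendsto_const_nhds.div_atTop tendsto_id).const_add a).pow d).mul
      ((tendsto_const_nhds.div_atTop tendsto_id).const_add c)).div_const _
  rw [add_zero, add_zero] at h
  refine h.congr' ?_
  filter_upwards [eventually_gt_atTop 0] with L hL
  have e1 : a * L + b = (a + b / L) * L := by field_simp
  have e2 : c * L + e = (c + e / L) * L := by field_simp
  rw [e1, e2, mul_pow, mul_pow, pow_succ L d]
  field_simp

theorem tendsto_log_one_div : Tendsto (fun ε : ℝ => Real.log (1 / ε)) (𝓝[>] 0) atTop := by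
  simp only [one_div]
  exact Real.tendsto_log_atTop.comp tendsto_inv_nhdsGT_zero

section

variable {d : ℕ} {X : Type*} [NormedAddCommGroup X] [NormedSpace ℝ X]
  {I : X →L[ℝ] C(UnitSphere d, ℝ)}

theorem operatorCoveringNumber_le {C ρ ε : ℝ} (hC : 0 ≤ C) (hρ : 0 ≤ ρ) (hρ1 : ρ < 1)
    (hI : ∀ f : X, ‖f‖ ≤ 1 → ∃ h : ℕ → C(UnitSphere d, ℝ), (∀ k, h k ∈ sphericalHarmonics d k) ∧
        (∀ k, ‖h k‖ ≤ C * ρ ^ k) ∧ HasSum h (I f)) (hε : 0 < ε) (N : ℕ)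
    (hN : C / (1 - ρ) * ρ ^ N ≤ ε / 2) :
    operatorCoveringNumber ε I ≤
      (⌊(1 + 4 * (C / (1 - ρ)) / ε) ^ Module.finrank ℝ (spherePoly d N)⌋₊ : ℕ) := by
  refine externalCoveringNumber_le_of_approx _ (spherePoly d N)
    (div_nonneg hC (sub_nonneg.2 hρ1.le)) hε ?_
  rintro _ ⟨f, hf, rfl⟩
  obtain ⟨h, h1, h2, h3⟩ := hI f (by simpa using hf)
  obtain ⟨v, hv, hvn, hfv⟩ := exists_approx_of_hasSum hC hρ hρ1 h1 h2 h3 N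
  exact ⟨v, hv, hvn, hfv.trans hN⟩

theorem operatorCoveringNumber_ne_top {C ρ ε : ℝ} (hC : 0 ≤ C) (hρ : 0 ≤ ρ) (hρ1 : ρ < 1)
    (hI : ∀ f : X, ‖f‖ ≤ 1 → ∃ h : ℕ → C(UnitSphere d, ℝ), (∀ k, h k ∈ sphericalHarmonics d k) ∧
        (∀ k, ‖h k‖ ≤ C * ρ ^ k) ∧ HasSum h (I f)) (hε : 0 < ε) :
    operatorCoveringNumber ε I ≠ ⊤ := by
  have ht := (tendsto_pow_atTop_nhds_zero_of_lt_one hρ hρ1).const_mul (C / (1 - ρ))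
  rw [mul_zero] at ht
  obtain ⟨N, hN⟩ := (ht.eventually_le_const (half_pos hε)).exists
  exact ((operatorCoveringNumber_le hC hρ hρ1 hI hε N hN).trans_lt (ENat.natCast_lt_top _)).ne

theorem limsup_entropyRatio_le {C ρ : ℝ} (hC : 0 < C) (hρ : 0 < ρ) (hρ1 : ρ < 1)
    (hI : ∀ f : X, ‖f‖ ≤ 1 → ∃ h : ℕ → C(UnitSphere d, ℝ), (∀ k, h k ∈ sphericalHarmonics d k) ∧
        (∀ k, ‖h k‖ ≤ C * ρ ^ k) ∧ HasSum h (I f)) :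
    limsup (entropyRatio d I) (𝓝[>] (0 : ℝ)) ≤
      ((1 / (d.factorial : ℝ) * (1 / (2 * Real.log (1 / ρ))) ^ d : ℝ) : EReal) := by
  set M := C / (1 - ρ)
  have hM : 0 < M := div_pos hC (sub_pos.2 hρ1)
  set l := Real.log (1 / ρ) with hl
  have hl0 : 0 < l := Real.log_pos (by rw [lt_div_iff₀ hρ]; linarith)
  have hlim := (((tendsto_pow_mul_div_pow d (1 / l) (|Real.log (2 * M)| / l + 2 + d) 1
    (Real.log (1 + 4 * M))).comp tendsto_log_one_div).const_mul (2 / (d.factorial : ℝ)))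
  have e : 2 / (d.factorial : ℝ) * ((1 / l) ^ d * 1 / 2 ^ (d + 1)) =
      1 / (d.factorial : ℝ) * (1 / (2 * l)) ^ d := by
    rw [one_div_mul_eq_div, div_pow, div_pow, mul_pow, pow_succ]; field_simp
  rw [e] at hlim
  rw [← (continuous_coe_real_ereal.continuousAt.tendsto.comp hlim).limsup_eq]
  refine limsup_le_limsup ?_
  filter_upwards [Ioo_mem_nhdsGT one_pos] with ε ⟨hε, hε1⟩
  set L := Real.log (1 / ε) with hL
  have hL0 : 0 < L := Real.log_pos (by rw [lt_div_iff₀ hε]; linarith)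
  simp only [entropyRatio, Function.comp_apply]
  rw [EReal.coe_le_coe_iff, ← hL, ← mul_div_assoc]
  gcongr
  -- The least degree for which the tail bound `M ρ^N` is at most `ε/2`.
  set N := ⌈(Real.log (2 * M) + L) / l⌉₊
  have hN : M * ρ ^ N ≤ ε / 2 := by
    have h1 : Real.log (2 * M) + L ≤ N * l := (div_le_iff₀ hl0).1 (Nat.le_ceil _)
    have h2 : ρ ^ N = Real.exp (-(N * l)) := by
      rw [hl, one_div, Real.log_inv, mul_neg, neg_neg, Real.exp_nat_mul, Real.exp_log hρ]
    calc M * ρ ^ N ≤ M * Real.exp (-(Real.log (2 * M) + L)) := by rw [h2]; gcongr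
      _ = ε / 2 := by
        rw [neg_add, Real.exp_add, Real.exp_neg, Real.exp_log (by positivity), hL, one_div,
          Real.log_inv, neg_neg, Real.exp_log hε]
        field_simp
  -- The logarithm may be negative; its absolute value makes the quotient nonnegative, as the bound
  -- on the ceiling requires.
  have hNle : (N : ℝ) ≤ (|Real.log (2 * M)| + L) / l + 1 := by
    have h1 : (Real.log (2 * M) + L) / l ≤ (|Real.log (2 * M)| + L) / l := by
      gcongr
      exact le_abs_self _
    have h2 : (N : ℝ) ≤ (⌈(|Real.log (2 * M)| + L) / l⌉₊ : ℝ) :=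
      Nat.cast_le.2 (Nat.ceil_mono h1)
    exact h2.trans (Nat.ceil_lt_add_one (by positivity)).le
  have hcov := operatorCoveringNumber_le hC.le hρ.le hρ1 hI hε N hN
  set D := Module.finrank ℝ (spherePoly d N)
  have h1 : ((operatorCoveringNumber ε I).toNat : ℝ) ≤ (1 + 4 * M / ε) ^ D := by
    have := ENat.toNat_le_of_le_natCast hcov
    exact (Nat.cast_le.2 this).trans (Nat.floor_le (by positivity))
  have h2 : Real.log ((operatorCoveringNumber ε I).toNat : ℝ) ≤ D * Real.log (1 + 4 * M / ε) := by
    rw [← Real.log_pow]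
    rcases Nat.eq_zero_or_pos (operatorCoveringNumber ε I).toNat with h0 | h0
    · rw [h0, Nat.cast_zero, Real.log_zero]
      refine Real.log_nonneg (one_le_pow₀ ?_)
      have : 0 < 4 * M / ε := by positivity
      linarith
    · exact Real.log_le_log (by exact_mod_cast h0) h1
  have h3 : Real.log (1 + 4 * M / ε) ≤ 1 * L + Real.log (1 + 4 * M) := by
    rw [one_mul, hL, ← Real.log_mul (by positivity) (by positivity)]
    refine Real.log_le_log (by positivity) ?_
    rw [one_div_mul_eq_div, add_div]
    gcongr
    rw [le_div_iff₀ hε]; linarith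
  have h4 : 0 ≤ Real.log (1 + 4 * M / ε) := Real.log_nonneg (by
      have : 0 < 4 * M / ε := by positivity
      linarith)
  calc Real.log ((operatorCoveringNumber ε I).toNat : ℝ) ≤ D * Real.log (1 + 4 * M / ε) := h2
    _ ≤ (2 / d.factorial * (N + 1 + d : ℝ) ^ d) * (1 * L + Real.log (1 + 4 * M)) := by
      gcongr
      exact finrank_spherePoly_le d N
    _ ≤ (2 / d.factorial * (1 / l * L + (|Real.log (2 * M)| / l + 2 + d)) ^ d) *
        (1 * L + Real.log (1 + 4 * M)) := by
      have : 0 ≤ 1 * L + Real.log (1 + 4 * M) := h4.trans h3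
      have h5 : (|Real.log (2 * M)| + L) / l = 1 / l * L + |Real.log (2 * M)| / l := by ring
      have h6 : (N + 1 + d : ℝ) ≤ 1 / l * L + (|Real.log (2 * M)| / l + 2 + d) := by linarith
      gcongr ?_ * ?_ ^ d * _
    _ = _ := by ring

theorem sphereIntegral_mul_self_le (f : C(UnitSphere d, ℝ)) :
    sphereIntegral d (f * f) ≤ ‖f‖ ^ 2 := by
  have h := (sphereIntegral d).le_of_opNorm_le (LinearMap.mkContinuous_norm_le _ zero_le_one _)
    (f * f)
  rw [one_mul] at h
  calc sphereIntegral d (f * f) ≤ ‖f * f‖ := (le_abs_self _).trans h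
    _ ≤ ‖f‖ * ‖f‖ := norm_mul_le _ _
    _ = ‖f‖ ^ 2 := (pow_two _).symm

/-- All harmonics of degree at most `N` form one orthonormal family. Synthesis from coefficients
therefore does not decrease norms, the sup norm dominating the L² norm of a probability measure, and
the volume comparison applies. -/
theorem sqrt_pow_le_operatorCoveringNumber (hd : 1 ≤ d) {δ ε : ℝ} (hδ : 0 < δ)
    {S : (k : ℕ) → Module.Basis (Fin (harmonicDim d k)) ℝ (sphericalHarmonics d k)}
    (hS : ∀ k i j, sphereIntegral d ((S k i : C(UnitSphere d, ℝ)) * (S k j : C(UnitSphere d, ℝ))) =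
      if i = j then 1 else 0) (N : ℕ)
    (hI : ∀ c : (k : ℕ) → EuclideanSpace ℝ (Fin (harmonicDim d k)),
        ∑ k ∈ Finset.range (N + 1), ‖c k‖ ^ 2 ≤ δ ^ N → ∃ f : X, ‖f‖ ≤ 1 ∧
          I f = ∑ k ∈ Finset.range (N + 1), ∑ j, c k j • (S k j : C(UnitSphere d, ℝ)))
    (hε : 0 < ε) (hfin : operatorCoveringNumber ε I ≠ ⊤) :
    √(δ ^ N) ^ (∑ k ∈ Finset.range (N + 1), harmonicDim d k) ≤
      (operatorCoveringNumber ε I).toNat *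
        (2 * ε) ^ (∑ k ∈ Finset.range (N + 1), harmonicDim d k) := by
  let J := (k : Fin (N + 1)) × Fin (harmonicDim d k)
  let S' : J → C(UnitSphere d, ℝ) := fun p => (S p.1 p.2 : C(UnitSphere d, ℝ))
  have hS' : ∀ p q : J, sphereIntegral d (S' p * S' q) = if p = q then 1 else 0 := by
    rintro ⟨k, i⟩ ⟨l, j⟩
    by_cases hkl : k = l
    · subst hkl
      refine (hS k i j).trans ?_
      by_cases hij : i = j
      · subst hij; simp
      · rw [if_neg hij, if_neg fun h => hij (by simpa [J] using h)]
    · rw [if_neg (fun h => hkl (congrArg Sigma.fst h))]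
      exact sphereIntegral_mul_eq_zero hd (fun h => hkl (Fin.ext h)) (S k i).2 (S l j).2
  let A : EuclideanSpace ℝ J →ₗ[ℝ] C(UnitSphere d, ℝ) :=
    { toFun := fun c => ∑ p, c p • S' p
      map_add' := fun c e => by simp [add_smul, Finset.sum_add_distrib]
      map_smul' := fun r c => by simp [mul_smul, Finset.smul_sum] }
  have hA : ∀ c, ‖c‖ ≤ ‖A c‖ := by
    intro c
    refine (sq_le_sq₀ (norm_nonneg _) (norm_nonneg _)).1 ?_
    rw [EuclideanSpace.real_norm_sq_eq, ← sphereIntegral_sq_sum S' hS']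
    exact sphereIntegral_mul_self_le (A c)
  have hrank : Module.finrank ℝ (EuclideanSpace ℝ J) =
      ∑ k ∈ Finset.range (N + 1), harmonicDim d k := by
    rw [finrank_euclideanSpace, Fintype.card_sigma, Finset.sum_range]
    simp
  have h := pow_le_externalCoveringNumber_mul_pow A hA (I '' Metric.closedBall 0 1)
    (r := √(δ ^ N)) (ε := ε) (by positivity) hε ?_ hfin
  · rw [hrank] at h
    exact h
  · intro c hc
    let c' : (k : ℕ) → EuclideanSpace ℝ (Fin (harmonicDim d k)) := fun k =>
      WithLp.toLp 2 fun j => if hk : k < N + 1 then c ⟨⟨k, hk⟩, j⟩ else 0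
    have hc' : ∀ (k : Fin (N + 1)) j, c' k j = c ⟨k, j⟩ := fun k j => dif_pos k.2
    obtain ⟨f, hf, hfI⟩ := hI c' <| by
      have hc2 := pow_le_pow_left₀ (norm_nonneg c) hc 2
      rw [Real.sq_sqrt (by positivity), EuclideanSpace.real_norm_sq_eq, Fintype.sum_sigma] at hc2
      rw [Finset.sum_range]
      simpa only [EuclideanSpace.real_norm_sq_eq, hc'] using hc2
    refine ⟨f, by simpa using hf, ?_⟩
    rw [hfI, Finset.sum_range]
    change _ = ∑ p : J, c p • S' p
    rw [Fintype.sum_sigma]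
    simp only [hc', S']

theorem le_liminf_entropyRatio (hd : 1 ≤ d) {δ : ℝ} (hδ : 0 < δ) (hδ1 : δ < 1)
    {S : (k : ℕ) → Module.Basis (Fin (harmonicDim d k)) ℝ (sphericalHarmonics d k)}
    (hS : ∀ k i j, sphereIntegral d ((S k i : C(UnitSphere d, ℝ)) * (S k j : C(UnitSphere d, ℝ))) =
      if i = j then 1 else 0)
    (hI : ∀ (N : ℕ) (c : (k : ℕ) → EuclideanSpace ℝ (Fin (harmonicDim d k))),
        ∑ k ∈ Finset.range (N + 1), ‖c k‖ ^ 2 ≤ δ ^ N → ∃ f : X, ‖f‖ ≤ 1 ∧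
          I f = ∑ k ∈ Finset.range (N + 1), ∑ j, c k j • (S k j : C(UnitSphere d, ℝ)))
    (hfin : ∀ ε : ℝ, 0 < ε → operatorCoveringNumber ε I ≠ ⊤) :
    ((1 / (2 * (Nat.factorial (d + 1) : ℝ)) *
        (((d : ℝ) / ((d : ℝ) + 1)) / Real.log (1 / δ)) ^ d : ℝ) : EReal) ≤
      liminf (entropyRatio d I) (𝓝[>] (0 : ℝ)) := by
  set l := Real.log (1 / δ) with hl
  have hl0 : 0 < l := Real.log_pos (by rw [lt_div_iff₀ hδ]; linarith)
  -- `N = 2aL/l` with this `a` maximizes `N^d (L - N l/2)`.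
  set a : ℝ := (d : ℝ) / ((d : ℝ) + 1) with ha
  have ha0 : 0 < a := by positivity
  have ha1 : 1 - a = 1 / ((d : ℝ) + 1) := by rw [ha]; field_simp; ring
  have hlim := (((tendsto_pow_mul_div_pow d (2 * a / l) (-1) (1 - a) (-Real.log 2)).comp
    tendsto_log_one_div).const_mul (1 / (d.factorial : ℝ)))
  have e : 1 / (d.factorial : ℝ) * ((2 * a / l) ^ d * (1 - a) / 2 ^ (d + 1)) =
      1 / (2 * (Nat.factorial (d + 1) : ℝ)) * (a / l) ^ d := by
    rw [ha1, Nat.factorial_succ, div_pow, div_pow, mul_pow, pow_succ]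
    push_cast
    field_simp
  rw [e] at hlim
  rw [← (continuous_coe_real_ereal.continuousAt.tendsto.comp hlim).liminf_eq]
  refine liminf_le_liminf ?_
  have hev : ∀ᶠ ε : ℝ in 𝓝[>] 0, max (l / (2 * a)) (Real.log 2 / (1 - a)) < Real.log (1 / ε) :=
    tendsto_log_one_div.eventually (eventually_gt_atTop _)
  filter_upwards [self_mem_nhdsWithin, hev] with ε hε hL
  replace hε : 0 < ε := hε
  set L := Real.log (1 / ε) with hLdef
  obtain ⟨hL1, hL2⟩ := max_lt_iff.1 hL
  have hL0 : 0 < L := lt_trans (by positivity) hL1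
  have h1a : 0 < 1 - a := by rw [ha1]; positivity
  rw [div_lt_iff₀ (by positivity)] at hL1 hL2
  simp only [entropyRatio, Function.comp_apply]
  rw [EReal.coe_le_coe_iff, ← hLdef, ← mul_div_assoc]
  gcongr
  set N := ⌊2 * a / l * L⌋₊
  have hN1 : 2 * a / l * L - 1 ≤ N := (Nat.sub_one_lt_floor _).le
  have hN2 : (N : ℝ) * l ≤ 2 * a * L := by
    have : (N : ℝ) ≤ 2 * a / l * L := Nat.floor_le (by positivity)
    rwa [div_mul_eq_mul_div, le_div_iff₀ hl0] at this
  have hN0 : 0 ≤ 2 * a / l * L - 1 := by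
    rw [sub_nonneg, div_mul_eq_mul_div, le_div_iff₀ hl0]
    linarith
  have h := sqrt_pow_le_operatorCoveringNumber hd hδ hS N (hI N) hε (hfin ε hε)
  have hm := pow_div_factorial_le_sum_harmonicDim d N
  set m := ∑ k ∈ Finset.range (N + 1), harmonicDim d k
  have hn : 0 < ((operatorCoveringNumber ε I).toNat : ℝ) := by
    by_contra! hn
    have : ((operatorCoveringNumber ε I).toNat : ℝ) = 0 := le_antisymm hn (Nat.cast_nonneg _)
    rw [this, zero_mul] at h
    exact absurd h (not_le.2 (by positivity))
  have hlog := Real.log_le_log (by positivity) h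
  rw [Real.log_mul hn.ne' (by positivity), Real.log_pow, Real.log_pow,
    Real.log_sqrt (by positivity), Real.log_pow, Real.log_mul two_ne_zero hε.ne'] at hlog
  have hlδ : Real.log δ = -l := by rw [hl, one_div, Real.log_inv, neg_neg]
  have hlε : Real.log ε = -L := by rw [hLdef, one_div, Real.log_inv, neg_neg]
  rw [hlδ, hlε] at hlog
  have h0 : 0 ≤ (1 - a) * L + -Real.log 2 := by linarith
  calc 1 / (d.factorial : ℝ) * ((2 * a / l * L + -1) ^ d * ((1 - a) * L + -Real.log 2))
      = (2 * a / l * L - 1) ^ d / d.factorial * ((1 - a) * L + -Real.log 2) := by ring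
    _ ≤ (N : ℝ) ^ d / d.factorial * ((1 - a) * L + -Real.log 2) := by gcongr
    _ ≤ m * ((1 - a) * L + -Real.log 2) := by gcongr
    _ ≤ m * (L - Real.log 2 - N * l / 2) := by gcongr; linarith
    _ ≤ Real.log ((operatorCoveringNumber ε I).toNat : ℝ) := by linarith

end

/-! ### Choice of the decay rate and conclusion -/

theorem exists_exponent_lt_one {d : ℕ} (hd : 1 ≤ d) :
    ∃ θ : ℝ, 0 < θ ∧ θ < 1 ∧ (1 / θ) ^ d ≤ 2 := by
  have hd' : (1 : ℝ) ≤ d := by exact_mod_cast hd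
  have h0 : (0 : ℝ) < 1 / (2 * d) := by positivity
  have h1 : (1 : ℝ) / (2 * d) ≤ 1 / 2 := by
    apply one_div_le_one_div_of_le <;> linarith
  -- Bernoulli's inequality gives `θ^d ≥ 1/2` for this `θ`.
  refine ⟨1 - 1 / (2 * d), by linarith, by linarith, ?_⟩
  have h := one_add_mul_le_pow (show (-2 : ℝ) ≤ -(1 / (2 * d)) by linarith) d
  have e : 1 + (d : ℝ) * -(1 / (2 * d)) = 1 / 2 := by field_simp; ring
  rw [e, ← sub_eq_add_neg] at h
  rw [one_div, inv_pow]
  exact inv_le_of_inv_le₀ two_pos (by simpa using h)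

/-- The rate `r = δ^θ > δ` absorbs the growth of the dimensions, and `θ^{-d} ≤ 2` pays for it. -/
theorem limsup_entropyRatio_le_two_div {d : ℕ} (hd : 1 ≤ d) {δ : ℝ} (hδ : 0 < δ) (hδ1 : δ < 1)
    {X : Type*} [NormedAddCommGroup X] [NormedSpace ℝ X] {I : X →L[ℝ] C(UnitSphere d, ℝ)}
    (hI : ∀ f : X, ‖f‖ ≤ 1 → ∃ h : ℕ → C(UnitSphere d, ℝ), (∀ k, h k ∈ sphericalHarmonics d k) ∧
        (∀ k, ‖h k‖ ≤ √(δ ^ k * harmonicDim d k)) ∧ HasSum h (I f)) :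
    (∀ ε : ℝ, 0 < ε → operatorCoveringNumber ε I ≠ ⊤) ∧
      limsup (entropyRatio d I) (𝓝[>] (0 : ℝ)) ≤
        ((2 / (d.factorial : ℝ) * (1 / Real.log (1 / δ) ^ d) : ℝ) : EReal) := by
  obtain ⟨θ, hθ, hθ1, hθ2⟩ := exists_exponent_lt_one hd
  obtain ⟨C, hC, hCk⟩ := exists_geometric_bound_harmonicDim d hδ
    (Real.self_lt_rpow_of_lt_one hδ hδ1 hθ1)
  set r := δ ^ θ with hr
  have hr0 : 0 < r := Real.rpow_pos_of_pos hδ _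
  have hr1 : r < 1 := Real.rpow_lt_one hδ.le hδ1 hθ
  have hρ1 : √r < 1 := by rw [Real.sqrt_lt' one_pos]; simpa using hr1
  have hρ : 0 < √r := Real.sqrt_pos.2 hr0
  have hI' : ∀ f : X, ‖f‖ ≤ 1 → ∃ h : ℕ → C(UnitSphere d, ℝ),
      (∀ k, h k ∈ sphericalHarmonics d k) ∧ (∀ k, ‖h k‖ ≤ √C * √r ^ k) ∧ HasSum h (I f) := by
    intro f hf
    obtain ⟨h, h1, h2, h3⟩ := hI f hf
    refine ⟨h, h1, fun k => (h2 k).trans ((Real.sqrt_le_sqrt (hCk k)).trans ?_), h3⟩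
    rw [Real.sqrt_mul hC.le, Real.sqrt_eq_rpow (r ^ k), Real.sqrt_eq_rpow r, ← Real.rpow_natCast,
      ← Real.rpow_natCast, ← Real.rpow_mul hr0.le, ← Real.rpow_mul hr0.le, mul_comm (k : ℝ)]
  have hC' : 0 < √C := Real.sqrt_pos.2 hC
  refine ⟨fun ε hε => operatorCoveringNumber_ne_top hC'.le hρ.le hρ1 hI' hε,
    (limsup_entropyRatio_le hC' hρ hρ1 hI').trans ?_⟩
  have hl0 : 0 < Real.log (1 / δ) := Real.log_pos (by rw [lt_div_iff₀ hδ]; linarith)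
  have hl : 2 * Real.log (1 / √r) = θ * Real.log (1 / δ) := by
    rw [one_div, one_div, Real.log_inv, Real.log_inv, Real.log_sqrt hr0.le, hr, Real.log_rpow hδ]
    ring
  rw [EReal.coe_le_coe_iff, hl]
  calc 1 / (d.factorial : ℝ) * (1 / (θ * Real.log (1 / δ))) ^ d
      = 1 / (d.factorial : ℝ) * (1 / θ) ^ d * (1 / Real.log (1 / δ) ^ d) := by
        rw [← one_div_mul_one_div, mul_pow, ← mul_assoc, one_div_pow (Real.log _)]
    _ ≤ 1 / (d.factorial : ℝ) * 2 * (1 / Real.log (1 / δ) ^ d) := by gcongr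
    _ = _ := by ring

theorem mainTheorem6 (d : ℕ) (hd : 1 ≤ d) (δ : ℝ) (hδ : 0 < δ)
    (hδ_one : d = 1 → δ < 1) (hδ_two : 2 ≤ d → δ < 1 / ((d : ℝ) + 3))
    {H : Type*} [NormedAddCommGroup H] [InnerProductSpace ℝ H] [CompleteSpace H]
    [RKHS ℝ H (UnitSphere d) ℝ]
    (hK : IsGaussianTypeKernel d δ (fun x y => RKHS.kernel H x y 1)) :
    ∃ I : H →L[ℝ] C(UnitSphere d, ℝ),
      (∀ (f : H) (x : UnitSphere d), I f x = f x) ∧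
      (∀ ε : ℝ, 0 < ε → operatorCoveringNumber ε I ≠ ⊤) ∧
      ((1 / (2 * (Nat.factorial (d + 1) : ℝ)) *
          (((d : ℝ) / ((d : ℝ) + 1)) / Real.log (Real.exp ((d : ℝ) - 1) / δ)) ^ d : ℝ) : EReal) ≤
        liminf (entropyRatio d I) (𝓝[>] (0 : ℝ)) ∧
      liminf (entropyRatio d I) (𝓝[>] (0 : ℝ)) ≤ limsup (entropyRatio d I) (𝓝[>] (0 : ℝ)) ∧
      (δ < 1 / ((d : ℝ) + 3) →
        limsup (entropyRatio d I) (𝓝[>] (0 : ℝ)) ≤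
          ((2 / (Nat.factorial d : ℝ) *
            (1 / Real.log (1 / (δ * ((d : ℝ) + 3))) ^ d) : ℝ) : EReal)) ∧
      (d = 1 →
        limsup (entropyRatio d I) (𝓝[>] (0 : ℝ)) ≤ ((2 / Real.log (1 / δ) : ℝ) : EReal)) := by
  have hd' : (1 : ℝ) ≤ d := by exact_mod_cast hd
  have hδ1 : δ < 1 := by
    rcases hd.eq_or_lt with h | h
    · exact hδ_one h.symm
    · refine (hδ_two h).trans_le ?_
      rw [div_le_one (by positivity)]
      linarith
  obtain ⟨S, hS, hsum⟩ := hK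
  obtain ⟨I, hI, hIup, hIlow⟩ := exists_embedding (H := H) hδ hδ1 hS hsum
  obtain ⟨hfin, hup⟩ := limsup_entropyRatio_le_two_div hd hδ hδ1 hIup
  have hl0 : 0 < Real.log (1 / δ) := Real.log_pos (by rw [lt_div_iff₀ hδ]; linarith)
  refine ⟨I, hI, hfin, ?_, liminf_le_limsup, fun hδ3 => hup.trans ?_, fun h1 => hup.trans ?_⟩
  -- Replacing `ln(1/δ)` by the larger `ln(e^{d-1}/δ)` weakens the lower bound.
  · refine le_trans ?_ (le_liminf_entropyRatio hd hδ hδ1 hS hIlow hfin)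
    rw [EReal.coe_le_coe_iff]
    have h1 : Real.log (1 / δ) ≤ Real.log (Real.exp ((d : ℝ) - 1) / δ) := by
      gcongr
      exact Real.one_le_exp (by linarith)
    have h2 := hl0.trans_le h1
    gcongr
  -- Replacing `δ` by `δ(d+3)` shrinks the logarithm, still positive, and weakens the upper bound.
  · rw [EReal.coe_le_coe_iff]
    have h3 : 0 < Real.log (1 / (δ * ((d : ℝ) + 3))) := by
      refine Real.log_pos ?_
      rw [lt_div_iff₀ (by positivity)] at hδ3 ⊢
      linarith
    gcongr
    exact le_mul_of_one_le_right hδ.le (by linarith)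
  · subst h1
    rw [EReal.coe_le_coe_iff]
    simp [div_eq_mul_inv]
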